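/- Notation. A tempered distribution $\sigma\in\mathcal S'(\mathbb R)$ (complex valued) is also viewed as a distribution on $\mathbb R$, by pairing it with $\psi\,dx$ for $\psi\in C_c^\infty(\mathbb R)$; its Fourier transform is $\langle\widehat\sigma,f\rangle=\langle\sigma,\widehat f\,\rangle$ with $\widehat f(y)=\int_{\mathbb R}f(x)e^{-2\pi i xy}\,dx$. The space $\mathbb R\cup\{\infty\}=\mathbb{RP}^1$ is the compact smooth manifold with the two charts $x$ and $y=1/x$; a distribution on it is a continuous linear functional on its space of smooth measures. A differential operator $D=\sum_{i} a_i\,\frac{d^i}{dx^i}$ (a finite sum) with $C^\infty$ coefficients on an open neighborhood $U$ of $0$ in $\mathbb R$ is tangential to $\{0\}$ if, for every $n\ge 0$, it maps smooth functions on $U$ vanishing to order $n$ at $0$ to functions of the same kind; here a smooth function vanishes to order $n$ at $0$ if its derivatives of order $<n$ vanish at $0$. A distribution $\sigma$ on $\mathbb R$ vanishes to order $k\ge 0$ at $0$ if there are an open neighborhood $U$ of $0$, smooth functions $f_1,\dots,f_N$ on $U$ vanishing to order $k$ at $0$, differential operators $D_1,\dots,D_N$ on $U$ tangential to $\{0\}$,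 and measurable, locally bounded functions $h_1,\dots,h_N\in L^\infty_{\mathrm{loc}}(U)$ such that $\sigma=\sum_{j=1}^N f_j\,D_j\,h_j$ as distributions on $U$. It vanishes to infinite order at $0$ if it vanishes to order $k$ for every $k\ge 0$. A distribution on $\mathbb R\cup\{\infty\}$ vanishes to order $k$ (or infinite order) at $\infty$ if, in the coordinate $y=1/x$, it vanishes to that order at $y=0$. Theorem. Let $\sigma$ be a tempered distribution on $\mathbb R$. (a) If $k\ge 0$ is an integer and $\sigma$ vanishes to order $k$ at $0$, then there is a distribution on $\mathbb R\cup\{\infty\}$ which restricts to $\widehat\sigma$ on $\mathbb R$ and vanishes to order $k$ at $\infty$. (b) If $\sigma$ vanishes to infinite order at $0$, then $\widehat\sigma$ has a canonical extension across $\infty$: there is a unique distribution on $\mathbb R\cup\{\infty\}$ which restricts to $\widehat\sigma$ on $\mathbb R$ and vanishes to infinite order at $\infty$. -/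

import Mathlib

open scoped Distributions SchwartzMap ContDiff FourierTransform

noncomputable section

namespace VanishingDist

open MeasureTheory

/-- Complex valued test functions on the real line. -/
abbrev Test : Type := 𝓓((⊤ : TopologicalSpace.Opens ℝ), ℂ)

/-! ### Differential operators and vanishing at the origin -/

/-- A linear differential operator `∑ i < len, coeff i * (d/dx) ^ i` with smooth coefficients on
the open set `U ⊆ ℝ`. The values of the coefficients outside `U` play no role. -/
structure DiffOp (U : Set ℝ) where
  len : ℕ
  coeff : ℕ → ℝ → ℂ
  smooth : ∀ i, ContDiffOn ℝ ∞ (coeff i) U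

/-- The action on functions, `D g = ∑ i, coeff i * g⁽ⁱ⁾`. -/
def DiffOp.app {U : Set ℝ} (D : DiffOp U) (g : ℝ → ℂ) (x : ℝ) : ℂ :=
  ∑ i ∈ Finset.range D.len, D.coeff i x * iteratedDeriv i g x

/-- The formal transpose, `Dᵗ g = ∑ i, (-1) ^ i * (coeff i * g)⁽ⁱ⁾`. The distribution `D h` is
by definition the functional `g ↦ ∫ h * Dᵗ g`. -/
def DiffOp.transpose {U : Set ℝ} (D : DiffOp U) (g : ℝ → ℂ) (x : ℝ) : ℂ :=
  ∑ i ∈ Finset.range D.len, (-1) ^ i * iteratedDeriv i (fun y ↦ D.coeff i y * g y) x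

/-- `f` is a smooth function on the open set `U` (a neighbourhood of `0`) that vanishes to order
`k` at `0`, i.e. it lies in the `k`-th power of the ideal of `{0}`. -/
def FunVanishes (k : ℕ) (U : Set ℝ) (f : ℝ → ℂ) : Prop :=
  ContDiffOn ℝ ∞ f U ∧ ∀ i < k, iteratedDeriv i f 0 = 0

/-- `D` is tangential to `{0}`: it preserves all powers of the ideal of `{0}`. -/
def DiffOp.Tangential {U : Set ℝ} (D : DiffOp U) : Prop :=
  ∀ (n : ℕ) (g : ℝ → ℂ), FunVanishes n U g → FunVanishes n U (D.app g)

/-- `h` is measurable and locally (essentially) bounded on `U`. -/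
def LocBounded (U : Set ℝ) (h : ℝ → ℂ) : Prop :=
  ∀ K ⊆ U, IsCompact K → MemLp h ⊤ (volume.restrict K)

/-- The distribution `T` on the real line vanishes to order `k` at `0`: on an open neighbourhood
`U` of `0` it equals `∑ j, f j * D j (h j)`, where `f j` is smooth and vanishes to order `k` at
`0`, `D j` is tangential to `{0}` and `h j` is measurable and locally bounded. The pairing of
`f D h` with a test function `ψ` supported in `U` is `∫ h * Dᵗ (f * ψ)`. -/
def VanishesAtZero (k : ℕ) (T : Test →ₗ[ℂ] ℂ) : Prop :=
  ∃ U : Set ℝ, IsOpen U ∧ (0 : ℝ) ∈ U ∧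
    ∃ (N : ℕ) (f : Fin N → ℝ → ℂ) (D : Fin N → DiffOp U) (h : Fin N → ℝ → ℂ),
      (∀ j, FunVanishes k U (f j)) ∧ (∀ j, (D j).Tangential) ∧ (∀ j, LocBounded U (h j)) ∧
      ∀ ψ : Test, tsupport ψ ⊆ U →
        T ψ = ∑ j, ∫ x, h j x * (D j).transpose (fun y ↦ f j y * ψ y) x

/-- The distribution on the real line underlying a tempered distribution. -/
def ofTempered (σ : 𝓢'(ℝ, ℂ)) : Test →ₗ[ℂ] ℂ where
  toFun ψ := σ (ψ.hasCompactSupport.toSchwartzMap ψ.contDiff)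
  map_add' ψ χ := by
    rw [← map_add]
    rfl
  map_smul' c ψ := by
    rw [RingHom.id_apply, ← map_smul]
    rfl

/-! ### The compactified real line `ℝ ∪ {∞}`

It is covered by the two charts with coordinates `x` and `y = 1 / x`, both with range `ℝ`. -/

/-- The space of smooth complex measures on the compact manifold `ℝ ∪ {∞}`. Such a measure is
given by its densities `u` (it is `u x dx` in the coordinate `x`) and `v` (it is `v y dy` in the
coordinate `y = 1 / x`), related by `v y = y⁻² * u (1 / y)` for `y ≠ 0`. -/
def smoothMeasures : Submodule ℂ ((ℝ → ℂ) × (ℝ → ℂ)) where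
  carrier := {μ | ContDiff ℝ ∞ μ.1 ∧ ContDiff ℝ ∞ μ.2 ∧
    ∀ y : ℝ, y ≠ 0 → μ.2 y = ((y : ℂ) ^ 2)⁻¹ * μ.1 y⁻¹}
  add_mem' := by
    rintro μ ν ⟨h₁, h₂, h₃⟩ ⟨g₁, g₂, g₃⟩
    refine ⟨h₁.add g₁, h₂.add g₂, fun y hy ↦ ?_⟩
    simp [h₃ y hy, g₃ y hy, mul_add]
  zero_mem' := ⟨contDiff_const, contDiff_const, fun y _ ↦ by simp⟩
  smul_mem' := by
    rintro c μ ⟨h₁, h₂, h₃⟩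
    refine ⟨contDiff_const.smul h₁, contDiff_const.smul h₂, fun y hy ↦ ?_⟩
    simp only [Prod.smul_fst, Prod.smul_snd, Pi.smul_apply, smul_eq_mul, h₃ y hy]
    ring

/-- A distribution on `ℝ ∪ {∞}`: a linear functional on the smooth measures that is continuous
for uniform convergence of all derivatives of the densities on compact sets of both charts. -/
structure ProjDist where
  toLin : smoothMeasures →ₗ[ℂ] ℂ
  bounded : ∃ (R C : ℝ) (N : ℕ), ∀ (μ : smoothMeasures) (A : ℝ),
    (∀ i ≤ N, ∀ x ∈ Set.Icc (-R) R,
      ‖iteratedDeriv i μ.1.1 x‖ ≤ A ∧ ‖iteratedDeriv i μ.1.2 x‖ ≤ A) → ‖toLin μ‖ ≤ C * A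

/-- The density of `ψ x dx` in the coordinate `1 / x`; its value at `0` is `0`. -/
def invDensity (ψ : ℝ → ℂ) (y : ℝ) : ℂ := ((y : ℂ) ^ 2)⁻¹ * ψ y⁻¹

theorem contDiff_invDensity (ψ : Test) : ContDiff ℝ ∞ (invDensity ψ) := by
  rw [contDiff_iff_contDiffAt]
  intro y
  by_cases hy : y = 0
  · subst hy
    obtain ⟨R, hR⟩ := ψ.hasCompactSupport.isBounded.subset_closedBall 0
    have hev : invDensity ψ =ᶠ[nhds 0] fun _ ↦ 0 := by
      have h1 : Metric.ball (0 : ℝ) (|R| + 1)⁻¹ ∈ nhds (0 : ℝ) :=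
        Metric.ball_mem_nhds _ (by positivity)
      filter_upwards [h1] with z hz
      by_cases hz0 : z = 0
      · simp [invDensity, hz0]
      · have hlt : |z| < (|R| + 1)⁻¹ := by simpa using hz
        have hpos : 0 < |z| := abs_pos.mpr hz0
        have h2 : |R| + 1 < |z⁻¹| := by
          rw [abs_inv]
          exact (lt_inv_comm₀ hpos (by positivity)).mp hlt
        have h3 : ψ z⁻¹ = 0 := by
          by_contra hne
          have h4 := hR (subset_tsupport _ (Function.mem_support.mpr hne))
          have h5 : |z⁻¹| ≤ R := by simpa using h4
          linarith [le_abs_self R]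
        simp [invDensity, h3]
    exact contDiffAt_const.congr_of_eventuallyEq hev
  · have hψ : ContDiff ℝ ∞ ψ := ψ.contDiff
    have h1 : ContDiffAt ℝ ∞ (fun y : ℝ ↦ ψ y⁻¹) y :=
      hψ.contDiffAt.comp y (contDiffAt_inv ℝ hy)
    have h2 : ContDiffAt ℝ ∞ (fun y : ℝ ↦ ((y : ℂ) ^ 2)⁻¹) y := by
      have h3 : ContDiffAt ℝ ∞ (fun y : ℝ ↦ ((y : ℂ) ^ 2)) y :=
        (Complex.ofRealCLM.contDiff.pow 2).contDiffAt
      exact h3.inv (by simpa using hy)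
    exact h2.mul h1

/-- The smooth measure `ψ x dx` on `ℝ ∪ {∞}`, supported in the chart with coordinate `x`. -/
def finiteMeasure : Test →ₗ[ℂ] smoothMeasures where
  toFun ψ := ⟨(ψ, invDensity ψ), ψ.contDiff, contDiff_invDensity ψ, fun _ _ ↦ rfl⟩
  map_add' ψ χ := by
    ext y
    · simp
    · simp [invDensity, mul_add]
  map_smul' c ψ := by
    ext y
    · simp
    · simp [invDensity, mul_left_comm]

/-- The smooth measure `ψ y dy` on `ℝ ∪ {∞}`, supported in the chart with coordinate
`y = 1 / x`. -/
def infiniteMeasure : Test →ₗ[ℂ] smoothMeasures where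
  toFun ψ := ⟨(invDensity ψ, ψ), contDiff_invDensity ψ, ψ.contDiff, fun y hy ↦ by
    have : (y : ℂ) ≠ 0 := by simpa using hy
    simp [invDensity, this]⟩
  map_add' ψ χ := by
    ext y
    · simp [invDensity, mul_add]
    · simp
  map_smul' c ψ := by
    ext y
    · simp [invDensity, mul_left_comm]
    · simp

/-- `T` is an extension to `ℝ ∪ {∞}` of the distribution `τ` on `ℝ`. -/
def ProjDist.Extends (T : ProjDist) (τ : Test →ₗ[ℂ] ℂ) : Prop :=
  T.toLin ∘ₗ finiteMeasure = τ

/-- `T` vanishes to order `k` at `∞`: in the coordinate `y = 1 / x`, it vanishes to order `k`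
at `y = 0`. -/
def ProjDist.VanishesAtInfinity (k : ℕ) (T : ProjDist) : Prop :=
  VanishesAtZero k (T.toLin ∘ₗ infiniteMeasure)

/-- The distribution `τ` on `ℝ` has a canonical extension across `∞`: there is a unique
distribution on `ℝ ∪ {∞}` that agrees with `τ` on `ℝ` and vanishes to infinite order at `∞`. -/
def HasCanonicalExtension (τ : Test →ₗ[ℂ] ℂ) : Prop :=
  ∃! T : ProjDist, T.Extends τ ∧ ∀ k, T.VanishesAtInfinity k

end VanishingDist

end

noncomputable section

namespace VanishingDist

open MeasureTheory

/-! Vanishing at a point is turned into an explicit normal form, and the Fourier transform is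
computed on it.

At the origin: testing a tangential operator on the monomials `x ^ n` shows that its `i`-th
coefficient vanishes to order `i`. Hence, after expanding transposes, a distribution vanishing to
order `k` is near `0` a combination of `u ↦ ∫ h * x ^ (k + i) * u⁽ⁱ⁾` with `h` integrable
(`VanishesAtZero.exists_originForm`). Conversely, such functionals with `h` locally bounded vanish
to order `k`, by means of the operators `x ^ l * (d/dx) ^ l`.

At infinity: the matching normal form is `u ↦ ∫ G * u⁽ᵏ⁺ⁿ⁾` with `|G| ≤ C * (1 + |x|) ^ n`. The
`m`-th derivative of a smooth density decays like `|x| ^ (-2 - m)`, so the integral converges on all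
smooth measures (`infinityForms_extends`). The substitution `y = 1 / x` turns it into a form at `y =
0` that vanishes to order `k` (`infinityForms_comp_invDensity_mem_vanishingForms`).

Existence: split `σ (𝓕 φ)` by a cutoff at the origin. Near `0` the Fourier transform exchanges `x ^
(k + l)` with `k + l` derivatives and replaces `h` by the bounded function `𝓕 h`, which gives a form
at infinity. Away from `0`, vanishing plays no role: dividing by a high power `x ^ i` puts `i`
derivatives on `φ`, and the remaining functional is given by a function whose polynomial growth does
not depend on `i` (`exists_infinityForm_away`).

Uniqueness: two extensions differ only at `∞`, and a form of any order tends to `0` on test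
functions cut off to shrinking neighborhoods, because `x ^ i * (d/dx) ^ i` is invariant under
scaling (`tendsto_originForms_cutoff`). Order `0` already suffices, so the extensions obtained for
the different `k` coincide. -/

/-! ### Iterated derivatives -/

/-- The Leibniz rule for smooth functions. -/
theorem iteratedDeriv_mul_apply {f g : ℝ → ℂ} {x : ℝ} (n : ℕ) (hf : ContDiffAt ℝ ∞ f x)
    (hg : ContDiffAt ℝ ∞ g x) :
    iteratedDeriv n (fun y ↦ f y * g y) x = ∑ i ∈ Finset.range (n + 1),
      n.choose i * iteratedDeriv i f x * iteratedDeriv (n - i) g x :=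
  iteratedDeriv_fun_mul (hf.of_le (mod_cast le_top)) (hg.of_le (mod_cast le_top))

theorem iteratedDeriv_iteratedDeriv_eq (f : ℝ → ℂ) (m n : ℕ) :
    iteratedDeriv m (iteratedDeriv n f) = iteratedDeriv (m + n) f := by
  simp only [iteratedDeriv_eq_iterate, Function.iterate_add_apply]

theorem contDiffOn_iteratedDeriv {U : Set ℝ} (hU : IsOpen U) {f : ℝ → ℂ}
    (hf : ContDiffOn ℝ ∞ f U) (n : ℕ) : ContDiffOn ℝ ∞ (iteratedDeriv n f) U := by
  induction n with
  | zero => simpa using hf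
  | succ n ih =>
    rw [iteratedDeriv_succ]
    exact ih.deriv_of_isOpen hU (by simp)

theorem contDiff_iteratedDeriv {f : ℝ → ℂ} (hf : ContDiff ℝ ∞ f) (n : ℕ) :
    ContDiff ℝ ∞ (iteratedDeriv n f) :=
  contDiffOn_univ.mp (contDiffOn_iteratedDeriv isOpen_univ hf.contDiffOn n)

theorem iteratedDeriv_ofReal_pow (n i : ℕ) (x : ℝ) :
    iteratedDeriv i (fun y : ℝ ↦ (y : ℂ) ^ n) x = n.descFactorial i * (x : ℂ) ^ (n - i) := by
  have h : (fun y : ℝ ↦ (y : ℂ) ^ n) = fun y : ℝ ↦ Complex.ofRealCLM (y ^ n) := by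
    ext y; simp
  have h2 := Complex.ofRealCLM.iteratedFDeriv_comp_left (n := i) (i := i) (f := fun y : ℝ ↦ y ^ n)
    (x := x) (by fun_prop) le_rfl
  have : iteratedDeriv i (fun y : ℝ ↦ Complex.ofRealCLM (y ^ n)) x
      = Complex.ofRealCLM (iteratedDeriv i (fun y : ℝ ↦ y ^ n) x) := by
    simp only [iteratedDeriv]
    exact congrArg (fun m ↦ m fun _ ↦ 1) h2
  rw [h, this, iteratedDeriv_pow]
  simp

theorem contDiff_ofReal_pow (n : ℕ) : ContDiff ℝ ∞ (fun y : ℝ ↦ (y : ℂ) ^ n) :=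
  Complex.ofRealCLM.contDiff.pow n

/-! ### Functions vanishing at the origin -/

theorem FunVanishes.mono {m n : ℕ} (h : m ≤ n) {U : Set ℝ} {f : ℝ → ℂ} (hf : FunVanishes n U f) :
    FunVanishes m U f :=
  ⟨hf.1, fun i hi ↦ hf.2 i (hi.trans_le h)⟩

theorem FunVanishes.mul {m n : ℕ} {U : Set ℝ} (hU : IsOpen U) (h0 : (0 : ℝ) ∈ U) {f g : ℝ → ℂ}
    (hf : FunVanishes m U f) (hg : FunVanishes n U g) :
    FunVanishes (m + n) U (fun y ↦ f y * g y) := by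
  refine ⟨hf.1.mul hg.1, fun i hi ↦ ?_⟩
  rw [iteratedDeriv_mul_apply i (hf.1.contDiffAt (hU.mem_nhds h0))
    (hg.1.contDiffAt (hU.mem_nhds h0))]
  refine Finset.sum_eq_zero fun j hj ↦ ?_
  rw [Finset.mem_range] at hj
  rcases lt_or_ge j m with h | h
  · simp [hf.2 j h]
  · simp [hg.2 (i - j) (by omega)]

theorem FunVanishes.iteratedDeriv {n : ℕ} {U : Set ℝ} (hU : IsOpen U) {f : ℝ → ℂ}
    (hf : FunVanishes n U f) (i : ℕ) : FunVanishes (n - i) U (iteratedDeriv i f) := by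
  refine ⟨contDiffOn_iteratedDeriv hU hf.1 i, fun j hj ↦ ?_⟩
  rw [iteratedDeriv_iteratedDeriv_eq]
  exact hf.2 _ (by omega)

theorem funVanishes_pow (n : ℕ) (U : Set ℝ) : FunVanishes n U (fun y : ℝ ↦ (y : ℂ) ^ n) := by
  refine ⟨(contDiff_ofReal_pow n).contDiffOn, fun i hi ↦ ?_⟩
  rw [iteratedDeriv_ofReal_pow]
  simp [show n - i ≠ 0 by omega]

/-- Taylor estimate, by induction on the order: the derivative satisfies the bound with exponent one
less, and the mean value inequality on the ball of radius `|x|` supplies the missing factor. -/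
theorem FunVanishes.exists_bound {n : ℕ} {U : Set ℝ} (hU : IsOpen U) {f : ℝ → ℂ}
    (hf : FunVanishes n U f) {ε : ℝ} (hε : 0 < ε) (hεU : Metric.closedBall 0 ε ⊆ U) :
    ∃ C, ∀ x ∈ Metric.closedBall (0 : ℝ) ε, ‖f x‖ ≤ C * |x| ^ n := by
  induction n generalizing f with
  | zero =>
    obtain ⟨C, hC⟩ := (isCompact_closedBall (0 : ℝ) ε).exists_bound_of_continuousOn
      (hf.1.continuousOn.mono hεU)
    exact ⟨C, fun x hx ↦ by simpa using hC x hx⟩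
  | succ n ih =>
    obtain ⟨C, hC⟩ := ih (f := deriv f) (by simpa using hf.iteratedDeriv hU 1)
    refine ⟨C, fun x hx ↦ ?_⟩
    have hsub : Metric.closedBall (0 : ℝ) |x| ⊆ Metric.closedBall 0 ε :=
      Metric.closedBall_subset_closedBall (by simpa using hx)
    have hC0 : 0 ≤ C := by
      have := (norm_nonneg _).trans (hC ε (by simp [abs_of_pos hε]))
      exact nonneg_of_mul_nonneg_left this (by positivity)
    have key := (convex_closedBall (0 : ℝ) |x|).norm_image_sub_le_of_norm_deriv_le (f := f)
      (C := C * |x| ^ n) (x := 0) (y := x)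
      (fun y hy ↦ (hf.1.contDiffAt (hU.mem_nhds (hεU (hsub hy)))).differentiableAt (by simp))
      (fun y hy ↦ (hC y (hsub hy)).trans (by
        have : |y| ≤ |x| := by simpa using hy
        gcongr)) (by simp) (by simp)
    have h0 : f 0 = 0 := by simpa using hf.2 0 (by omega)
    rw [h0, sub_zero, sub_zero, Real.norm_eq_abs] at key
    rw [pow_succ, ← mul_assoc]
    exact key

/-- The coefficients of a tangential operator vanish to the order of differentiation. -/
theorem DiffOp.Tangential.coeff_vanishes {U : Set ℝ} (hU : IsOpen U) (h0 : (0 : ℝ) ∈ U)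
    {D : DiffOp U} (hD : D.Tangential) {n : ℕ} (hn : n < D.len) :
    FunVanishes n U (D.coeff n) := by
  induction n using Nat.strong_induction_on with
  | _ n ih =>
    refine ⟨D.smooth n, fun i hi ↦ ?_⟩
    -- Test on `x ^ n`: terms with `j > n` are zero, terms with `j < n` vanish to order `n` by
    -- induction, and the term `j = n` is `n!` times the coefficient.
    have hv := (hD n _ (funVanishes_pow n U)).2 i hi
    have happ : D.app (fun y : ℝ ↦ (y : ℂ) ^ n) = fun x ↦ ∑ j ∈ Finset.range D.len,
        D.coeff j x * (n.descFactorial j * (x : ℂ) ^ (n - j)) := by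
      ext x
      simp [DiffOp.app, iteratedDeriv_ofReal_pow]
    have hsm : ∀ j, ContDiffAt ℝ ∞ (fun x : ℝ ↦
        D.coeff j x * (n.descFactorial j * (x : ℂ) ^ (n - j))) 0 := fun j ↦
      ((D.smooth j).contDiffAt (hU.mem_nhds h0)).mul
        (contDiffAt_const.mul (contDiff_ofReal_pow _).contDiffAt)
    rw [happ, iteratedDeriv_fun_sum fun j _ ↦ (hsm j).of_le (mod_cast le_top),
      Finset.sum_eq_single_of_mem n (Finset.mem_range.mpr hn)] at hv
    · simp only [Nat.descFactorial_self, Nat.sub_self, pow_zero, mul_one,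
        iteratedDeriv_mul_const_field, mul_eq_zero, Nat.cast_eq_zero,
        Nat.factorial_ne_zero, or_false] at hv
      exact hv
    · intro j hj hjn
      rcases lt_or_gt_of_ne hjn with h | h
      · have h1 := (ih j h (Finset.mem_range.mp hj)).mul hU h0 (funVanishes_pow (n - j) U)
        have h2 : (fun x : ℝ ↦ D.coeff j x * (n.descFactorial j * (x : ℂ) ^ (n - j))) =
            fun x ↦ n.descFactorial j * (D.coeff j x * (x : ℂ) ^ (n - j)) := by
          ext x; ring
        rw [h2, iteratedDeriv_const_mul_field, h1.2 i (by omega), mul_zero]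
      · simp [Nat.descFactorial_of_lt h]

/-! ### Normal forms near the origin -/

theorem iteratedDeriv_eq_zero_of_notMem_tsupport {f : ℝ → ℂ} {x : ℝ} (hx : x ∉ tsupport f)
    (n : ℕ) : iteratedDeriv n f x = 0 := by
  rw [(notMem_tsupport_iff_eventuallyEq.mp hx).iteratedDeriv_eq n]
  simp [Pi.zero_def]

theorem hasCompactSupport_iteratedDeriv {f : ℝ → ℂ} (hf : HasCompactSupport f) (n : ℕ) :
    HasCompactSupport (iteratedDeriv n f) :=
  hf.mono' fun x hx ↦ by
    by_contra h
    exact hx (iteratedDeriv_eq_zero_of_notMem_tsupport h n)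

/-- A compactly supported smooth function, as a test function. -/
def testOf (f : ℝ → ℂ) (hf : ContDiff ℝ ∞ f) (hc : HasCompactSupport f) : Test :=
  ⟨f, hf, hc, fun _ _ ↦ trivial⟩

theorem integrable_mul_of_hasCompactSupport {h u : ℝ → ℂ} (hh : Integrable h) (hu : Continuous u)
    (hc : HasCompactSupport u) : Integrable fun x ↦ h x * u x := by
  obtain ⟨C, hC⟩ := hu.bounded_above_of_compact_support hc
  exact hh.mul_bdd hu.aestronglyMeasurable (ae_of_all _ hC)

/-- The functional `u ↦ ∫ h * x ^ (k + i) * u⁽ⁱ⁾`. -/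
def originForm (k i : ℕ) (h u : ℝ → ℂ) : ℂ :=
  ∫ x : ℝ, h x * ((x : ℂ) ^ (k + i) * iteratedDeriv i u x)

/-- Linear combinations of the functionals `u ↦ ∫ h * x ^ (k + i) * u⁽ⁱ⁾` with integrable `h`. -/
def originForms (k : ℕ) : Submodule ℂ ((ℝ → ℂ) → ℂ) :=
  Submodule.span ℂ {Φ | ∃ i h, Integrable h ∧ Φ = originForm k i h}

theorem integrable_originForm {h u : ℝ → ℂ} (hh : Integrable h) (hu : ContDiff ℝ ∞ u)
    (hc : HasCompactSupport u) (n i : ℕ) :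
    Integrable fun x : ℝ ↦ h x * ((x : ℂ) ^ n * iteratedDeriv i u x) :=
  integrable_mul_of_hasCompactSupport hh
    ((contDiff_ofReal_pow n).continuous.mul (contDiff_iteratedDeriv hu i).continuous)
    (hasCompactSupport_iteratedDeriv hc i).mul_left

theorem FunVanishes.div_mul_cancel {n : ℕ} {U : Set ℝ} {g : ℝ → ℂ} (hg : FunVanishes n U g)
    (x : ℝ) : g x / (x : ℂ) ^ n * (x : ℂ) ^ n = g x := by
  by_cases hx : x = 0
  · subst hx
    rcases Nat.eq_zero_or_pos n with rfl | hn
    · simp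
    · have : g 0 = 0 := by simpa using hg.2 0 hn
      simp [this]
  · exact div_mul_cancel₀ _ (pow_ne_zero _ (by simpa using hx))

/-- The Taylor estimate bounds `g / x ^ n` on the ball. The indicator makes the product a globally
integrable function, so the normal form no longer refers to `U`. -/
theorem FunVanishes.integrable_indicator {n : ℕ} {U : Set ℝ} (hU : IsOpen U) {g h : ℝ → ℂ}
    (hg : FunVanishes n U g) (hh : LocBounded U h) {ε : ℝ} (hε : 0 < ε)
    (hεU : Metric.closedBall 0 ε ⊆ U) :
    Integrable ((Metric.closedBall (0 : ℝ) ε).indicator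
      fun x : ℝ ↦ h x * (g x / (x : ℂ) ^ n)) := by
  have hm : MeasurableSet (Metric.closedBall (0 : ℝ) ε) := measurableSet_closedBall
  rw [integrable_indicator_iff hm]
  have : IsFiniteMeasure (volume.restrict (Metric.closedBall (0 : ℝ) ε)) :=
    ⟨by rw [Measure.restrict_apply_univ]; exact measure_closedBall_lt_top⟩
  obtain ⟨C, hC⟩ := hg.exists_bound hU hε hεU
  have hInt := (hh _ hεU (isCompact_closedBall 0 ε)).integrable le_top
  refine hInt.mul_bdd (c := |C|) ?_ ?_
  · refine AEMeasurable.aestronglyMeasurable ?_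
    exact ((hg.1.continuousOn.mono hεU).aemeasurable hm).div
      (contDiff_ofReal_pow n).continuous.measurable.aemeasurable
  · filter_upwards [ae_restrict_mem hm] with x hx
    rw [norm_div, norm_pow, Complex.norm_real, Real.norm_eq_abs]
    refine div_le_of_le_mul₀ (by positivity) (by positivity) ((hC x hx).trans ?_)
    gcongr
    exact le_abs_self C

/-- The product of `f j` and the `i`-th coefficient vanishes to order `k + i`. If `r` of the `i`
derivatives in the transpose fall on it, it still vanishes to order `k + (i - r)`, while `ψ`
receives `i - r` derivatives; dividing by `x ^ (k + (i - r))` leaves a bounded factor that is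
absorbed into `h`. -/
theorem VanishesAtZero.exists_originForm {k : ℕ} {T : Test →ₗ[ℂ] ℂ} (hT : VanishesAtZero k T) :
    ∃ ε > 0, ∃ Φ ∈ originForms k, ∀ ψ : Test, tsupport ψ ⊆ Metric.closedBall 0 ε → T ψ = Φ ψ := by
  obtain ⟨U, hU, h0, N, f, D, h, hf, hD, hh, hT⟩ := hT
  obtain ⟨ε, hε, hεU⟩ := Metric.nhds_basis_closedBall.mem_iff.mp (hU.mem_nhds h0)
  let g (j : Fin N) (i r : ℕ) : ℝ → ℂ := iteratedDeriv r fun y ↦ (D j).coeff i y * f j y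
  have hg (j : Fin N) (i : ℕ) (hi : i < (D j).len) (r : ℕ) (hr : r ≤ i) :
      FunVanishes (k + (i - r)) U (g j i r) :=
    (((hD j).coeff_vanishes hU h0 hi |>.mul hU h0 (hf j)).iteratedDeriv hU r).mono (by omega)
  let H (j : Fin N) (i r : ℕ) : ℝ → ℂ := (Metric.closedBall (0 : ℝ) ε).indicator
    fun x ↦ h j x * (g j i r x / (x : ℂ) ^ (k + (i - r)))
  have hH (j : Fin N) (i : ℕ) (hi : i < (D j).len) (r : ℕ) (hr : r ≤ i) : Integrable (H j i r) :=
    (hg j i hi r hr).integrable_indicator hU (hh j) hε hεU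
  refine ⟨ε, hε, ∑ j, ∑ i ∈ Finset.range (D j).len, ∑ r ∈ Finset.range (i + 1),
    ((-1) ^ i * (i.choose r : ℂ)) • originForm k (i - r) (H j i r), ?_, fun ψ hψ ↦ ?_⟩
  · refine Submodule.sum_mem _ fun j _ ↦ Submodule.sum_mem _ fun i hi ↦
      Submodule.sum_mem _ fun r hr ↦ Submodule.smul_mem _ _ (Submodule.subset_span ?_)
    exact ⟨_, _, hH j i (Finset.mem_range.mp hi) r (by simpa [Nat.lt_succ_iff] using hr), rfl⟩
  · rw [hT ψ (hψ.trans hεU)]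
    simp only [Finset.sum_apply, Pi.smul_apply, smul_eq_mul]
    refine Finset.sum_congr rfl fun j _ ↦ ?_
    have key : (fun x ↦ h j x * (D j).transpose (fun y ↦ f j y * ψ y) x) = fun x ↦
        ∑ i ∈ Finset.range (D j).len, ∑ r ∈ Finset.range (i + 1), ((-1) ^ i * (i.choose r : ℂ)) *
          (H j i r x * ((x : ℂ) ^ (k + (i - r)) * iteratedDeriv (i - r) ψ x)) := by
      ext x
      simp only [DiffOp.transpose, Finset.mul_sum]
      refine Finset.sum_congr rfl fun i hi ↦ ?_
      by_cases hx : x ∈ Metric.closedBall (0 : ℝ) ε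
      · have e1 : (fun y ↦ (D j).coeff i y * (f j y * ψ y)) =
            fun y ↦ ((D j).coeff i y * f j y) * ψ y := by ext y; ring
        have hxU := hU.mem_nhds (hεU hx)
        rw [e1, iteratedDeriv_mul_apply i ((((D j).smooth i).mul (hf j).1).contDiffAt hxU)
          ψ.contDiff.contDiffAt, Finset.mul_sum, Finset.mul_sum]
        refine Finset.sum_congr rfl fun r hr ↦ ?_
        have e2 := (hg j i (Finset.mem_range.mp hi) r
          (by simpa [Nat.lt_succ_iff] using hr)).div_mul_cancel x
        simp only [H, Set.indicator_of_mem hx]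
        change _ * (_ * (_ * g j i r x * _)) = _
        linear_combination (-(h j x) * (-1) ^ i * (i.choose r : ℂ) *
          iteratedDeriv (i - r) ψ x) * e2
      · have hx' : x ∉ tsupport ψ := fun h ↦ hx (hψ h)
        have e1 : (fun y ↦ (D j).coeff i y * (f j y * ψ y)) =ᶠ[nhds x] fun _ ↦ 0 := by
          filter_upwards [notMem_tsupport_iff_eventuallyEq.mp hx'] with y hy
          simp [hy]
        rw [e1.iteratedDeriv_eq]
        simp [H, Set.indicator_of_notMem hx]
    have hInt : ∀ i ∈ Finset.range (D j).len, ∀ r ∈ Finset.range (i + 1), Integrable fun x : ℝ ↦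
        ((-1) ^ i * (i.choose r : ℂ)) *
          (H j i r x * ((x : ℂ) ^ (k + (i - r)) * iteratedDeriv (i - r) ψ x)) :=
      fun i hi r hr ↦ (integrable_originForm (hH j i (Finset.mem_range.mp hi) r
        (by simpa [Nat.lt_succ_iff] using hr)) ψ.contDiff ψ.hasCompactSupport _ _).const_mul _
    rw [key, integral_finsetSum _ fun i hi ↦ integrable_finsetSum _ (hInt i hi)]
    refine Finset.sum_congr rfl fun i hi ↦ ?_
    rw [integral_finsetSum _ (hInt i hi)]
    refine Finset.sum_congr rfl fun r _ ↦ ?_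
    rw [integral_const_mul, originForm]

/-! ### Uniqueness of extensions across the origin -/

/-- Dominated convergence: for each `x ≠ 0` the point `n * x` eventually leaves the support of `m`.
-/
theorem tendsto_integral_mul_comp_mul {h m : ℝ → ℂ} (hh : Integrable h) (hm : Continuous m)
    (hc : HasCompactSupport m) :
    Filter.Tendsto (fun n : ℕ ↦ ∫ x : ℝ, h x * m (n * x)) Filter.atTop (nhds 0) := by
  obtain ⟨C, hC⟩ := hm.bounded_above_of_compact_support hc
  rw [show (0 : ℂ) = ∫ _ : ℝ, (0 : ℂ) by simp]
  refine tendsto_integral_of_dominated_convergence (fun x ↦ ‖h x‖ * C) (fun n ↦ ?_)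
    (hh.norm.mul_const C) (fun n ↦ ae_of_all _ fun x ↦ ?_) ?_
  · exact hh.aestronglyMeasurable.mul (hm.comp (by fun_prop)).aestronglyMeasurable
  · rw [norm_mul]
    gcongr
    exact hC _
  · have h0 : ∀ᵐ x : ℝ, x ≠ 0 := by simp [ae_iff, measure_singleton]
    filter_upwards [h0] with x hx
    obtain ⟨R, hR⟩ := hc.isBounded.subset_closedBall 0
    refine tendsto_const_nhds.congr' ?_
    filter_upwards [Filter.eventually_gt_atTop ⌈|R| / |x|⌉₊] with n hn
    have hn' : |R| / |x| < n := (Nat.le_ceil _).trans_lt (by exact_mod_cast hn)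
    rw [div_lt_iff₀ (abs_pos.mpr hx)] at hn'
    have : m (n * x) = 0 := by
      by_contra hne
      have h4 := hR (subset_tsupport _ (Function.mem_support.mpr hne))
      have h5 : |(n : ℝ) * x| ≤ R := by simpa using h4
      rw [abs_mul, Nat.abs_cast] at h5
      linarith [le_abs_self R]
    simp [this]

theorem tendsto_originForms_cutoff {k : ℕ} {Φ : (ℝ → ℂ) → ℂ} (hΦ : Φ ∈ originForms k)
    {χ ψ : ℝ → ℂ} (hχ : ContDiff ℝ ∞ χ) (hχc : HasCompactSupport χ) (hψ : ContDiff ℝ ∞ ψ)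
    (hψc : HasCompactSupport ψ) :
    Filter.Tendsto (fun n : ℕ ↦ Φ fun x : ℝ ↦ χ (n * x) * ψ x) Filter.atTop (nhds 0) := by
  induction hΦ using Submodule.span_induction with
  | zero => exact tendsto_const_nhds
  | add Φ₁ Φ₂ _ _ h₁ h₂ => simpa using h₁.add h₂
  | smul c Φ _ h => simpa using h.const_smul c
  | mem Φ hΦ =>
    obtain ⟨i, h, hh, rfl⟩ := hΦ
    -- The `r` derivatives of `χ (n * x)` produce `n ^ r`, which joins `x ^ r` to form `(n * x) ^
    -- r`. So each Leibniz term is a fixed integrable function times a rescaled fixed bump.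
    let m (r : ℕ) (t : ℝ) : ℂ := (t : ℂ) ^ r * iteratedDeriv r χ t
    have hm (r : ℕ) : Continuous (m r) :=
      (contDiff_ofReal_pow r).continuous.mul (contDiff_iteratedDeriv hχ r).continuous
    have hmc (r : ℕ) : HasCompactSupport (m r) := (hasCompactSupport_iteratedDeriv hχc r).mul_left
    let h' (r : ℕ) (x : ℝ) : ℂ := h x * ((x : ℂ) ^ (k + (i - r)) * iteratedDeriv (i - r) ψ x)
    have hh' (r : ℕ) : Integrable (h' r) := integrable_originForm hh hψ hψc _ _
    have key (n : ℕ) : originForm k i h (fun x : ℝ ↦ χ (n * x) * ψ x) =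
        ∑ r ∈ Finset.range (i + 1), (i.choose r : ℂ) * ∫ x : ℝ, h' r x * m r (n * x) := by
      have hInt (r : ℕ) : Integrable fun x : ℝ ↦ (i.choose r : ℂ) * (h' r x * m r (n * x)) := by
        obtain ⟨C, hC⟩ := (hm r).bounded_above_of_compact_support (hmc r)
        exact ((hh' r).mul_bdd ((hm r).comp (by fun_prop)).aestronglyMeasurable
          (ae_of_all _ fun x ↦ hC _)).const_mul _
      simp_rw [← integral_const_mul]
      rw [← integral_finsetSum _ fun r _ ↦ hInt r, originForm]
      congr 1
      ext x
      rw [iteratedDeriv_mul_apply i (f := fun x : ℝ ↦ χ (n * x))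
          (hχ.comp (contDiff_const.mul contDiff_id)).contDiffAt hψ.contDiffAt,
        Finset.mul_sum, Finset.mul_sum]
      refine Finset.sum_congr rfl fun r hr ↦ ?_
      rw [iteratedDeriv_comp_const_smul (hχ.of_le (mod_cast le_top)),
        show k + i = k + (i - r) + r by have := Finset.mem_range.mp hr; omega, pow_add]
      simp only [h', m, Complex.real_smul]
      push_cast
      ring
    simp_rw [key]
    rw [show (0 : ℂ) = ∑ r ∈ Finset.range (i + 1), (i.choose r : ℂ) * 0 by simp]
    exact tendsto_finsetSum _ fun r _ ↦
      (tendsto_integral_mul_comp_mul (hh' r) (hm r) (hmc r)).const_mul _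

/-! ### Cutoff functions -/

/-- A smooth function that is `1` on `[-1, 1]` and `0` outside `[-2, 2]`. -/
def cutoff (x : ℝ) : ℂ := ((⟨1, 2, one_pos, one_lt_two⟩ : ContDiffBump (0 : ℝ)) x : ℝ)

theorem contDiff_cutoff : ContDiff ℝ ∞ cutoff :=
  Complex.ofRealCLM.contDiff.comp (ContDiffBump.contDiff _)

theorem cutoff_eq_one {x : ℝ} (hx : |x| ≤ 1) : cutoff x = 1 := by
  rw [cutoff, ContDiffBump.one_of_mem_closedBall _ (by simpa using hx)]
  simp

theorem cutoff_eq_zero {x : ℝ} (hx : 2 ≤ |x|) : cutoff x = 0 := by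
  rw [cutoff, ContDiffBump.zero_of_le_dist _ (by simpa using hx)]
  simp

theorem contDiff_cutoff_mul (c : ℝ) : ContDiff ℝ ∞ fun x ↦ cutoff (c * x) :=
  contDiff_cutoff.comp (contDiff_const.mul contDiff_id)

theorem tsupport_cutoff_mul_subset {c : ℝ} (hc : 0 < c) (u : ℝ → ℂ) :
    tsupport (fun x ↦ cutoff (c * x) * u x) ⊆ Metric.closedBall 0 (2 / c) := by
  refine closure_minimal (fun x hx ↦ ?_) Metric.isClosed_closedBall
  by_contra h
  have h' : 2 / c < |x| := by simpa using h
  rw [div_lt_iff₀ hc] at h'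
  refine hx ?_
  have : cutoff (c * x) = 0 := cutoff_eq_zero (by rw [abs_mul, abs_of_pos hc]; linarith)
  simp [this]

theorem hasCompactSupport_cutoff_mul {c : ℝ} (hc : 0 < c) (u : ℝ → ℂ) :
    HasCompactSupport fun x ↦ cutoff (c * x) * u x :=
  (isCompact_closedBall 0 (2 / c)).of_isClosed_subset (isClosed_tsupport _)
    (tsupport_cutoff_mul_subset hc u)

theorem hasCompactSupport_cutoff : HasCompactSupport cutoff := by
  simpa using hasCompactSupport_cutoff_mul one_pos fun _ ↦ 1

/-! ### Uniqueness of the extension across infinity -/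

theorem invDensity_invDensity {ψ : ℝ → ℂ} (y : ℝ) (h : y ≠ 0 ∨ ψ 0 = 0) :
    invDensity (invDensity ψ) y = ψ y := by
  by_cases hy : y = 0
  · subst hy
    simpa [invDensity] using (h.resolve_left (by simp)).symm
  · have : (y : ℂ) ≠ 0 := by simpa using hy
    simp [invDensity, this]

theorem hasCompactSupport_of_eq_zero {u : ℝ → ℂ} (R : ℝ) (h : ∀ x, R < |x| → u x = 0) :
    HasCompactSupport u :=
  HasCompactSupport.of_support_subset_isCompact (isCompact_closedBall 0 R) fun x hx ↦ by
    by_contra hR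
    exact hx (h x (by simpa using hR))

theorem hasCompactSupport_invDensity {ψ : ℝ → ℂ} {δ : ℝ} (hδ : 0 < δ)
    (h : ∀ y, |y| < δ → ψ y = 0) : HasCompactSupport (invDensity ψ) := by
  refine hasCompactSupport_of_eq_zero δ⁻¹ fun x hx ↦ ?_
  have : ψ x⁻¹ = 0 := h _ (by rw [abs_inv]; exact inv_lt_of_inv_lt₀ hδ hx)
  simp [invDensity, this]

theorem infiniteMeasure_eq_finiteMeasure {ψ : Test} {δ : ℝ} (hδ : 0 < δ)
    (h : ∀ y, |y| < δ → ψ y = 0) :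
    infiniteMeasure ψ = finiteMeasure
      (testOf (invDensity ψ) (contDiff_invDensity ψ) (hasCompactSupport_invDensity hδ h)) := by
  refine Subtype.ext (Prod.ext rfl (funext fun y ↦ ?_))
  exact (invDensity_invDensity y (Or.inr (h 0 (by simpa using hδ)))).symm

/-- Partition of unity on the projective line: a functional on smooth measures is determined by its
restrictions to the two charts. -/
theorem exists_eq_finiteMeasure_add_infiniteMeasure (μ : smoothMeasures) :
    ∃ φ ψ : Test, μ = finiteMeasure φ + infiniteMeasure ψ := by
  obtain ⟨⟨u, v⟩, hu, hv, huv⟩ := μ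
  simp only at hu hv huv
  let φ : Test := testOf (fun x ↦ cutoff x * u x) (contDiff_cutoff.mul hu)
    hasCompactSupport_cutoff.mul_right
  have hφ (x : ℝ) : φ x = cutoff x * u x := rfl
  have hcs : HasCompactSupport fun y ↦ v y - invDensity φ y := by
    refine hasCompactSupport_of_eq_zero 1 fun y hy ↦ ?_
    have hy0 : y ≠ 0 := by rintro rfl; norm_num at hy
    rw [huv y hy0, invDensity, hφ,
      cutoff_eq_one (by rw [abs_inv]; exact inv_le_one_of_one_le₀ hy.le)]
    simp
  let ψ : Test := testOf _ (hv.sub (contDiff_invDensity φ)) hcs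
  have hψ (x : ℝ) : ψ x = v x - invDensity φ x := rfl
  refine ⟨φ, ψ, Subtype.ext (Prod.ext (funext fun x ↦ ?_) (funext fun y ↦ ?_))⟩
  · change u x = φ x + invDensity ψ x
    by_cases hx : x = 0
    -- At `0` the default value of `invDensity` is `0`, which is right because the cutoff equals `1`
    -- there.
    · simp [hx, hφ, invDensity, cutoff_eq_one]
    · have hx' : (x : ℂ) ≠ 0 := by simpa using hx
      rw [invDensity, hψ, huv _ (inv_ne_zero hx), invDensity]
      simp [hx', mul_sub]
  · change v y = invDensity φ y + (v y - invDensity φ y)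
    ring

/-- Removing a neighborhood of `y = 0` from `ψ` leaves a measure supported in the finite chart,
where both extensions equal `τ`. Hence the difference of the two values depends only on `ψ` cut off
to `|y| ≤ 2 / n`, and this contribution tends to `0`. -/
theorem ProjDist.apply_infiniteMeasure_eq {k : ℕ} {τ : Test →ₗ[ℂ] ℂ} {T₁ T₂ : ProjDist}
    (h₁ : T₁.Extends τ) (h₂ : T₂.Extends τ) (v₁ : T₁.VanishesAtInfinity k)
    (v₂ : T₂.VanishesAtInfinity k) (ψ : Test) :
    T₁.toLin (infiniteMeasure ψ) = T₂.toLin (infiniteMeasure ψ) := by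
  obtain ⟨ε₁, hε₁, Φ₁, hΦ₁, e₁⟩ := VanishesAtZero.exists_originForm v₁
  obtain ⟨ε₂, hε₂, Φ₂, hΦ₂, e₂⟩ := VanishesAtZero.exists_originForm v₂
  have t := (tendsto_originForms_cutoff hΦ₁ contDiff_cutoff hasCompactSupport_cutoff ψ.contDiff
    ψ.hasCompactSupport).sub (tendsto_originForms_cutoff hΦ₂ contDiff_cutoff
      hasCompactSupport_cutoff ψ.contDiff ψ.hasCompactSupport)
  rw [sub_zero] at t
  refine sub_eq_zero.mp (tendsto_nhds_unique (tendsto_const_nhds.congr' ?_) t)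
  filter_upwards [Filter.eventually_gt_atTop ⌈2 / min ε₁ ε₂⌉₊] with n hn
  have hε : 0 < min ε₁ ε₂ := lt_min hε₁ hε₂
  have hn' : 2 / min ε₁ ε₂ < n := (Nat.le_ceil _).trans_lt (by exact_mod_cast hn)
  have hn0 : (0 : ℝ) < n := (by positivity : 0 < 2 / min ε₁ ε₂).trans hn'
  have hle : 2 / (n : ℝ) ≤ min ε₁ ε₂ := by
    rw [div_lt_iff₀ hε] at hn'
    rw [div_le_iff₀ hn0]
    linarith
  let χψ : Test := testOf (fun x : ℝ ↦ cutoff (n * x) * ψ x)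
    ((contDiff_cutoff_mul n).mul ψ.contDiff) (hasCompactSupport_cutoff_mul hn0 ψ)
  have hsupp : tsupport χψ ⊆ Metric.closedBall 0 (2 / n) := tsupport_cutoff_mul_subset hn0 ψ
  have a₁ := e₁ χψ (hsupp.trans (Metric.closedBall_subset_closedBall
    (hle.trans (min_le_left _ _))))
  have a₂ := e₂ χψ (hsupp.trans (Metric.closedBall_subset_closedBall
    (hle.trans (min_le_right _ _))))
  have hzero : ∀ y : ℝ, |y| < (n : ℝ)⁻¹ → (ψ - χψ) y = 0 := by
    intro y hy
    have : cutoff (n * y) = 1 := cutoff_eq_one (by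
      rw [abs_mul, abs_of_pos hn0]
      calc (n : ℝ) * |y| ≤ n * (n : ℝ)⁻¹ := by gcongr
        _ = 1 := mul_inv_cancel₀ hn0.ne')
    change ψ y - cutoff (n * y) * ψ y = 0
    simp [this]
  have hfin : T₁.toLin (infiniteMeasure (ψ - χψ)) = T₂.toLin (infiniteMeasure (ψ - χψ)) := by
    rw [infiniteMeasure_eq_finiteMeasure (inv_pos.mpr hn0) hzero]
    exact (LinearMap.congr_fun h₁ _).trans (LinearMap.congr_fun h₂ _).symm
  simp only [map_sub] at hfin
  simp only [LinearMap.comp_apply] at a₁ a₂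
  change _ = Φ₁ χψ - Φ₂ χψ
  rw [← a₁, ← a₂]
  linear_combination hfin

theorem ProjDist.eq_of_vanishesAtInfinity {k : ℕ} {τ : Test →ₗ[ℂ] ℂ} {T₁ T₂ : ProjDist}
    (h₁ : T₁.Extends τ) (h₂ : T₂.Extends τ) (v₁ : T₁.VanishesAtInfinity k)
    (v₂ : T₂.VanishesAtInfinity k) : T₁ = T₂ := by
  have : T₁.toLin = T₂.toLin := by
    refine LinearMap.ext fun μ ↦ ?_
    obtain ⟨φ, ψ, rfl⟩ := exists_eq_finiteMeasure_add_infiniteMeasure μ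
    rw [map_add, map_add, apply_infiniteMeasure_eq h₁ h₂ v₁ v₂]
    congr 1
    exact (LinearMap.congr_fun h₁ _).trans (LinearMap.congr_fun h₂ _).symm
  cases T₁; cases T₂; congr

theorem VanishesAtZero.mono {m n : ℕ} (h : m ≤ n) {T : Test →ₗ[ℂ] ℂ} (hT : VanishesAtZero n T) :
    VanishesAtZero m T := by
  obtain ⟨U, hU, h0, N, f, D, g, hf, hD, hg, e⟩ := hT
  exact ⟨U, hU, h0, N, f, D, g, fun j ↦ (hf j).mono h, hD, hg, e⟩

/-! ### Sufficient conditions for vanishing at the origin -/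

theorem LocBounded.integrable_mul {h u : ℝ → ℂ} (hh : LocBounded Set.univ h) (hu : Continuous u)
    (hc : HasCompactSupport u) : Integrable fun x ↦ h x * u x := by
  have hK : IsCompact (tsupport u) := hc
  have : IsFiniteMeasure (volume.restrict (tsupport u)) :=
    ⟨by rw [Measure.restrict_apply_univ]; exact hK.measure_lt_top⟩
  have hInt : Integrable h (volume.restrict (tsupport u)) :=
    (hh _ (Set.subset_univ _) hK).integrable le_top
  obtain ⟨C, hC⟩ := hu.bounded_above_of_compact_support hc
  rw [← integrableOn_iff_integrable_of_support_subset (s := tsupport u)]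
  · exact hInt.mul_bdd hu.aestronglyMeasurable (ae_of_all _ hC)
  · intro x hx
    exact subset_tsupport _ (right_ne_zero_of_mul hx)

/-- Linear combinations of the functionals `f D h` on the line, where `f` vanishes to order `k` at
`0`, `D` is tangential and `h` is locally bounded. -/
def vanishingForms (k : ℕ) : Submodule ℂ (Test → ℂ) :=
  Submodule.span ℂ {Φ | ∃ (f : ℝ → ℂ) (D : DiffOp Set.univ) (h : ℝ → ℂ),
    FunVanishes k Set.univ f ∧ D.Tangential ∧ LocBounded Set.univ h ∧
      Φ = fun ψ : Test ↦ ∫ x, h x * D.transpose (fun y ↦ f y * ψ y) x}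

theorem LocBounded.const_mul {U : Set ℝ} {h : ℝ → ℂ} (hh : LocBounded U h) (c : ℂ) :
    LocBounded U fun x ↦ c * h x :=
  fun K hK hc ↦ (hh K hK hc).const_mul c

theorem vanishesAtZero_of_mem_vanishingForms {k : ℕ} {T : Test →ₗ[ℂ] ℂ}
    (hT : ⇑T ∈ vanishingForms k) : VanishesAtZero k T := by
  obtain ⟨N, c, g, hg⟩ := Submodule.mem_span_set'.mp hT
  choose f D h hf hD hh e using fun j ↦ (g j).2
  refine ⟨Set.univ, isOpen_univ, trivial, N, f, D, fun j x ↦ c j * h j x, hf, hD,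
    fun j ↦ (hh j).const_mul (c j), fun ψ _ ↦ ?_⟩
  rw [← congrFun hg ψ]
  simp only [Finset.sum_apply, Pi.smul_apply, smul_eq_mul, e, mul_assoc, integral_const_mul]

/-- The operator `x ^ l * (d/dx) ^ l`. -/
def eulerOp (l : ℕ) : DiffOp Set.univ where
  len := l + 1
  coeff i x := if i = l then (x : ℂ) ^ l else 0
  smooth i := by
    split_ifs
    · exact (contDiff_ofReal_pow l).contDiffOn
    · exact contDiffOn_const

theorem eulerOp_app (l : ℕ) (g : ℝ → ℂ) :
    (eulerOp l).app g = fun x : ℝ ↦ (x : ℂ) ^ l * iteratedDeriv l g x := by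
  ext x
  rw [DiffOp.app, Finset.sum_eq_single_of_mem l (by simp [eulerOp])]
  · simp [eulerOp]
  · intro i _ hi
    simp [eulerOp, hi]

theorem eulerOp_transpose (l : ℕ) (g : ℝ → ℂ) (x : ℝ) :
    (eulerOp l).transpose g x = (-1) ^ l * iteratedDeriv l (fun y : ℝ ↦ (y : ℂ) ^ l * g y) x := by
  rw [DiffOp.transpose, Finset.sum_eq_single_of_mem l (by simp [eulerOp])]
  · simp [eulerOp]
  · intro i _ hi
    simp [eulerOp, hi]

theorem eulerOp_tangential (l : ℕ) : (eulerOp l).Tangential := by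
  intro n g hg
  rw [eulerOp_app]
  exact ((funVanishes_pow l Set.univ).mul isOpen_univ trivial
    (hg.iteratedDeriv isOpen_univ l)).mono (by omega)

/-- Apply `eulerOp l` to `h` and multiply by `x ^ k`. Up to sign this gives the wanted functional
plus terms of the same shape with smaller `l`, which are removed by strong induction. -/
theorem integral_mul_pow_mul_iteratedDeriv_mem_vanishingForms (k l : ℕ) {h : ℝ → ℂ}
    (hh : LocBounded Set.univ h) :
    (fun ψ : Test ↦ ∫ x : ℝ, h x * ((x : ℂ) ^ (k + l) * iteratedDeriv l ψ x)) ∈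
      vanishingForms k := by
  induction l using Nat.strong_induction_on with
  | _ l ih =>
    have hmem : (fun ψ : Test ↦ ∫ x, h x * (eulerOp l).transpose
        (fun y : ℝ ↦ (y : ℂ) ^ k * ψ y) x) ∈ vanishingForms k :=
      Submodule.subset_span
        ⟨_, eulerOp l, h, funVanishes_pow k _, eulerOp_tangential l, hh, rfl⟩
    -- These are the Leibniz terms in which `r + 1 ≥ 1` derivatives fall on `x ^ (k + l)`.
    have hsum : (fun ψ : Test ↦ ∑ r ∈ Finset.range l,
        (l.choose (r + 1) * (k + l).descFactorial (r + 1) : ℂ) *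
          ∫ x : ℝ, h x * ((x : ℂ) ^ (k + (l - (r + 1))) * iteratedDeriv (l - (r + 1)) ψ x)) ∈
        vanishingForms k := by
      have : ∀ r ∈ Finset.range l, _ := fun r hr ↦ Submodule.smul_mem _
        (l.choose (r + 1) * (k + l).descFactorial (r + 1) : ℂ)
        (ih (l - (r + 1)) (by have := Finset.mem_range.mp hr; omega))
      convert Submodule.sum_mem _ this using 1
      ext ψ
      simp
    convert Submodule.sub_mem _ (Submodule.smul_mem _ ((-1 : ℂ) ^ l) hmem) hsum using 1
    ext ψ
    have hInt (a b : ℕ) (c : ℂ) : Integrable fun x : ℝ ↦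
        c * (h x * ((x : ℂ) ^ a * iteratedDeriv b ψ x)) :=
      (hh.integrable_mul ((contDiff_ofReal_pow a).continuous.mul
        (contDiff_iteratedDeriv ψ.contDiff b).continuous)
        (hasCompactSupport_iteratedDeriv ψ.hasCompactSupport b).mul_left).const_mul c
    have key : (fun x ↦ h x * (eulerOp l).transpose (fun y : ℝ ↦ (y : ℂ) ^ k * ψ y) x) =
        fun x : ℝ ↦ (-1) ^ l * (∑ r ∈ Finset.range (l + 1),
          (l.choose r * (k + l).descFactorial r : ℂ) *
            (h x * ((x : ℂ) ^ (k + (l - r)) * iteratedDeriv (l - r) ψ x))) := by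
      ext x
      have e : (fun y : ℝ ↦ (y : ℂ) ^ l * ((y : ℂ) ^ k * ψ y)) =
          fun y : ℝ ↦ (y : ℂ) ^ (k + l) * ψ y := by
        ext y; ring
      rw [eulerOp_transpose, e, iteratedDeriv_mul_apply l (contDiff_ofReal_pow _).contDiffAt
        ψ.contDiff.contDiffAt, Finset.mul_sum, Finset.mul_sum, Finset.mul_sum]
      refine Finset.sum_congr rfl fun r hr ↦ ?_
      rw [iteratedDeriv_ofReal_pow,
        show k + l - r = k + (l - r) by have := Finset.mem_range.mp hr; omega]
      ring
    simp only [Pi.sub_apply, Pi.smul_apply, smul_eq_mul]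
    rw [key, integral_const_mul, integral_finsetSum _ fun r _ ↦ hInt _ _ _, ← mul_assoc,
      ← mul_pow, neg_one_mul, neg_neg, one_pow, one_mul, Finset.sum_range_succ']
    simp [integral_const_mul]

/-! ### Extending functionals across infinity -/

/-- Linear combinations of the functionals `u ↦ ∫ G * u⁽ᵏ⁺ⁿ⁾` where `G` grows at most like
`|x| ^ n`. -/
def infinityForms (k : ℕ) : Submodule ℂ ((ℝ → ℂ) → ℂ) :=
  Submodule.span ℂ {Φ | ∃ (n : ℕ) (G : ℝ → ℂ) (C : ℝ), Measurable G ∧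
    (∀ x, ‖G x‖ ≤ C * (1 + |x|) ^ n) ∧ Φ = fun u ↦ ∫ x, G x * iteratedDeriv (k + n) u x}

/-- The derivatives of a density in the coordinate `x`, in terms of the coordinate `1 / x`. -/
theorem exists_iteratedDeriv_invDensity_eq (i : ℕ) : ∃ c : ℕ → ℂ, ∀ v : ℝ → ℂ, ContDiff ℝ ∞ v →
    ∀ x : ℝ, x ≠ 0 → iteratedDeriv i (invDensity v) x =
      ∑ l ∈ Finset.range (i + 1), c l * ((x⁻¹ : ℝ) : ℂ) ^ (2 + i + l) * iteratedDeriv l v x⁻¹ := by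
  induction i with
  | zero => exact ⟨fun _ ↦ 1, fun v _ x _ ↦ by simp [invDensity]⟩
  | succ i ih =>
    obtain ⟨c, hc⟩ := ih
    -- The first summand comes from differentiating the power of `x⁻¹`; the second is the chain rule
    -- term, which shifts `l` by one.
    refine ⟨fun l ↦ (if l ≤ i then -(2 + i + l) * c l else 0) +
      (if l = 0 then 0 else -c (l - 1)), fun v hv x hx ↦ ?_⟩
    have hinv : HasDerivAt (fun y : ℝ ↦ y⁻¹) (-(x⁻¹) ^ 2) x := by
      simpa using hasDerivAt_inv hx
    have hterm (l : ℕ) : HasDerivAt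
        (fun y : ℝ ↦ c l * ((y⁻¹ : ℝ) : ℂ) ^ (2 + i + l) * iteratedDeriv l v y⁻¹)
        (-(2 + i + l) * c l * ((x⁻¹ : ℝ) : ℂ) ^ (2 + (i + 1) + l) * iteratedDeriv l v x⁻¹ +
          -c l * ((x⁻¹ : ℝ) : ℂ) ^ (2 + (i + 1) + (l + 1)) * iteratedDeriv (l + 1) v x⁻¹) x := by
      have h1 := (hinv.ofReal_comp.pow (2 + i + l)).const_mul (c l)
      have h2 : HasDerivAt (iteratedDeriv l v) (iteratedDeriv (l + 1) v x⁻¹) x⁻¹ := by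
        rw [iteratedDeriv_succ]
        exact ((contDiff_iteratedDeriv hv l).differentiable (by simp)).differentiableAt.hasDerivAt
      have h3 := h2.scomp x hinv
      refine HasDerivAt.congr_deriv (h1.mul h3) ?_
      simp only [Complex.real_smul, Pi.pow_apply]
      rw [show 2 + (i + 1) + l = (2 + i + l - 1) + 2 by omega,
        show 2 + (i + 1) + (l + 1) = (2 + i + l) + 2 by omega]
      push_cast
      ring
    rw [iteratedDeriv_succ]
    have hev : iteratedDeriv i (invDensity v) =ᶠ[nhds x] fun y ↦ ∑ l ∈ Finset.range (i + 1),
        c l * ((y⁻¹ : ℝ) : ℂ) ^ (2 + i + l) * iteratedDeriv l v y⁻¹ := by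
      filter_upwards [isOpen_ne.mem_nhds hx] with y hy using hc v hv y hy
    rw [hev.deriv_eq, (HasDerivAt.fun_sum fun l _ ↦ hterm l).deriv, Finset.sum_add_distrib]
    simp only [add_mul]
    rw [Finset.sum_add_distrib]
    congr 1
    · rw [Finset.sum_range_succ _ (i + 1), if_neg (by omega), zero_mul, zero_mul, add_zero]
      refine Finset.sum_congr rfl fun l hl ↦ ?_
      rw [if_pos (by simpa [Nat.lt_succ_iff] using hl)]
    · rw [Finset.sum_range_succ' _ (i + 1)]
      simp

theorem smoothMeasures_fst_eqOn (μ : smoothMeasures) :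
    Set.EqOn μ.1.1 (invDensity μ.1.2) {0}ᶜ := by
  intro x hx
  have hx' : (x : ℂ) ≠ 0 := by simpa using hx
  rw [invDensity, μ.2.2.2 _ (inv_ne_zero hx)]
  simp [hx']

/-- The unit intervals of the two charts cover the projective line. For `|x| ≥ 1` the `m`-th
derivative is `O(|x| ^ (-2 - m))`, so for `n ≤ m` the weight still leaves the integrable decay `|x|
^ (-2)`. -/
theorem exists_bound_iteratedDeriv_fst {m n : ℕ} (hnm : n ≤ m) : ∃ B, 0 ≤ B ∧
    ∀ (μ : smoothMeasures) (A : ℝ), (∀ i ≤ m, ∀ x ∈ Set.Icc (-1 : ℝ) 1,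
      ‖iteratedDeriv i μ.1.1 x‖ ≤ A ∧ ‖iteratedDeriv i μ.1.2 x‖ ≤ A) →
    ∀ x, (1 + |x|) ^ n * ‖iteratedDeriv m μ.1.1 x‖ ≤ B * A * (1 + x ^ 2)⁻¹ := by
  obtain ⟨c, hc⟩ := exists_iteratedDeriv_invDensity_eq m
  set S := ∑ l ∈ Finset.range (m + 1), ‖c l‖ with hS
  have hS0 : 0 ≤ S := Finset.sum_nonneg fun _ _ ↦ norm_nonneg _
  -- `2 ^ n` bounds the weight by `1` or `|x| ^ n`, `1 + S` serves both regions, and the last `2`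
  -- compares `1` or `|x| ^ (-2)` with `(1 + x ^ 2)⁻¹`.
  refine ⟨2 ^ n * ((1 + S) * 2), by positivity, fun μ A hA x ↦ ?_⟩
  have hA0 : 0 ≤ A := (norm_nonneg _).trans (hA 0 (Nat.zero_le _) 0 (by simp)).1
  rcases le_total |x| 1 with hx | hx
  · have h1 := (hA m le_rfl x (abs_le.mp hx)).1
    have h2 : 1 ≤ 2 * (1 + x ^ 2)⁻¹ := by
      rw [← div_eq_mul_inv, le_div_iff₀ (by positivity)]
      have := (sq_le_one_iff_abs_le_one x).mpr hx
      linarith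
    calc (1 + |x|) ^ n * ‖iteratedDeriv m μ.1.1 x‖ ≤ (1 + 1) ^ n * A := by gcongr
      _ = 2 ^ n * (1 * A) * 1 := by norm_num
      _ ≤ 2 ^ n * ((1 + S) * A) * (2 * (1 + x ^ 2)⁻¹) := by gcongr; linarith
      _ = _ := by ring
  · have hx0 : x ≠ 0 := by rintro rfl; norm_num at hx
    have hpos : 0 < |x| := abs_pos.mpr hx0
    have hinv : |x⁻¹| ≤ 1 := by rw [abs_inv]; exact inv_le_one_of_one_le₀ hx
    have h1 : ‖iteratedDeriv m μ.1.1 x‖ ≤ |x⁻¹| ^ (2 + m) * (S * A) := by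
      rw [(smoothMeasures_fst_eqOn μ).iteratedDeriv_of_isOpen isOpen_compl_singleton m hx0,
        hc _ μ.2.2.1 x hx0, hS, Finset.sum_mul, Finset.mul_sum]
      refine (norm_sum_le _ _).trans (Finset.sum_le_sum fun l hl ↦ ?_)
      rw [norm_mul, norm_mul, norm_pow, Complex.norm_real, Real.norm_eq_abs]
      have h2 := (hA l (by simpa [Nat.lt_succ_iff] using hl) x⁻¹ (abs_le.mp hinv)).2
      have h3 : |x⁻¹| ^ (2 + m + l) ≤ |x⁻¹| ^ (2 + m) :=
        pow_le_pow_of_le_one (abs_nonneg _) hinv (by omega)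
      calc ‖c l‖ * |x⁻¹| ^ (2 + m + l) * ‖iteratedDeriv l μ.1.2 x⁻¹‖
          ≤ ‖c l‖ * |x⁻¹| ^ (2 + m) * A := by gcongr
        _ = _ := by ring
    have h2 : |x⁻¹| ^ (2 + m) ≤ |x⁻¹| ^ (2 + n) :=
      pow_le_pow_of_le_one (abs_nonneg _) hinv (by omega)
    have h3 : |x⁻¹| ^ 2 ≤ 2 * (1 + x ^ 2)⁻¹ := by
      rw [sq_abs, inv_pow, ← div_eq_mul_inv, inv_eq_one_div, div_le_div_iff₀ (by positivity)
        (by positivity)]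
      have := (one_le_sq_iff_one_le_abs x).mpr hx
      linarith
    calc (1 + |x|) ^ n * ‖iteratedDeriv m μ.1.1 x‖
        ≤ (|x| + |x|) ^ n * (|x⁻¹| ^ (2 + n) * (S * A)) := by
          gcongr
          exact h1.trans (by gcongr)
      _ = 2 ^ n * (S * A) * |x⁻¹| ^ 2 := by
          rw [← two_mul, mul_pow, pow_add, abs_inv, inv_pow |x| n]
          field_simp
      _ ≤ 2 ^ n * ((1 + S) * A) * (2 * (1 + x ^ 2)⁻¹) := by gcongr; linarith
      _ = _ := by ring

theorem exists_bound_smoothMeasures (μ : smoothMeasures) (m : ℕ) :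
    ∃ A, ∀ i ≤ m, ∀ x ∈ Set.Icc (-1 : ℝ) 1,
      ‖iteratedDeriv i μ.1.1 x‖ ≤ A ∧ ‖iteratedDeriv i μ.1.2 x‖ ≤ A := by
  have h (u : ℝ → ℂ) (hu : ContDiff ℝ ∞ u) (i : ℕ) : ∃ A, 0 ≤ A ∧ ∀ x ∈ Set.Icc (-1 : ℝ) 1,
      ‖iteratedDeriv i u x‖ ≤ A := by
    obtain ⟨A, hA⟩ := isCompact_Icc.exists_bound_of_continuousOn (s := Set.Icc (-1 : ℝ) 1)
      (contDiff_iteratedDeriv hu i).continuous.continuousOn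
    exact ⟨|A|, abs_nonneg _, fun x hx ↦ (hA x hx).trans (le_abs_self A)⟩
  choose a ha0 ha using h μ.1.1 μ.2.1
  choose b hb0 hb using h μ.1.2 μ.2.2.1
  refine ⟨∑ i ∈ Finset.range (m + 1), (a i + b i), fun i hi x hx ↦ ?_⟩
  have h1 : a i + b i ≤ ∑ i ∈ Finset.range (m + 1), (a i + b i) :=
    Finset.single_le_sum (f := fun i ↦ a i + b i) (fun j _ ↦ add_nonneg (ha0 j) (hb0 j))
      (Finset.mem_range.mpr (by omega))
  constructor
  · linarith [ha i x hx, hb0 i]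
  · linarith [hb i x hx, ha0 i]

theorem infinityForms_extends {k : ℕ} {Φ : (ℝ → ℂ) → ℂ} (hΦ : Φ ∈ infinityForms k) :
    ∃ T : smoothMeasures →ₗ[ℂ] ℂ, (∀ μ, T μ = Φ μ.1.1) ∧
      ∃ (C : ℝ) (N : ℕ), ∀ (μ : smoothMeasures) (A : ℝ), (∀ i ≤ N, ∀ x ∈ Set.Icc (-1 : ℝ) 1,
        ‖iteratedDeriv i μ.1.1 x‖ ≤ A ∧ ‖iteratedDeriv i μ.1.2 x‖ ≤ A) → ‖T μ‖ ≤ C * A := by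
  induction hΦ using Submodule.span_induction with
  | zero => exact ⟨0, fun _ ↦ rfl, 0, 0, fun μ A _ ↦ by simp⟩
  | add Φ₁ Φ₂ _ _ h₁ h₂ =>
    obtain ⟨T₁, e₁, C₁, N₁, b₁⟩ := h₁
    obtain ⟨T₂, e₂, C₂, N₂, b₂⟩ := h₂
    refine ⟨T₁ + T₂, fun μ ↦ by simp [e₁, e₂], C₁ + C₂, max N₁ N₂, fun μ A hA ↦ ?_⟩
    rw [add_mul]
    exact (norm_add_le _ _).trans (add_le_add
      (b₁ μ A fun i hi ↦ hA i (hi.trans (le_max_left _ _)))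
      (b₂ μ A fun i hi ↦ hA i (hi.trans (le_max_right _ _))))
  | smul c Φ _ h =>
    obtain ⟨T, e, C, N, b⟩ := h
    refine ⟨c • T, fun μ ↦ by simp [e], ‖c‖ * C, N, fun μ A hA ↦ ?_⟩
    rw [LinearMap.smul_apply, norm_smul, mul_assoc]
    gcongr
    exact b μ A hA
  | mem Φ hΦ =>
    obtain ⟨n, G, C, hG, hGC, rfl⟩ := hΦ
    have hC0 : 0 ≤ C := by simpa using (norm_nonneg _).trans (hGC 0)
    obtain ⟨B, hB0, hB⟩ := exists_bound_iteratedDeriv_fst (Nat.le_add_left n k)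
    have hbound (μ : smoothMeasures) (A : ℝ) (hA : ∀ i ≤ k + n, ∀ x ∈ Set.Icc (-1 : ℝ) 1,
        ‖iteratedDeriv i μ.1.1 x‖ ≤ A ∧ ‖iteratedDeriv i μ.1.2 x‖ ≤ A) (x : ℝ) :
        ‖G x * iteratedDeriv (k + n) μ.1.1 x‖ ≤ C * (B * A) * (1 + x ^ 2)⁻¹ := by
      rw [norm_mul]
      calc ‖G x‖ * ‖iteratedDeriv (k + n) μ.1.1 x‖
          ≤ C * (1 + |x|) ^ n * ‖iteratedDeriv (k + n) μ.1.1 x‖ := by gcongr; exact hGC x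
        _ = C * ((1 + |x|) ^ n * ‖iteratedDeriv (k + n) μ.1.1 x‖) := by ring
        _ ≤ C * (B * A * (1 + x ^ 2)⁻¹) :=
          mul_le_mul_of_nonneg_left (hB μ A hA x) hC0
        _ = _ := by ring
    have hInt (μ : smoothMeasures) : Integrable fun x ↦ G x * iteratedDeriv (k + n) μ.1.1 x := by
      obtain ⟨A, hA⟩ := exists_bound_smoothMeasures μ (k + n)
      exact (integrable_inv_one_add_sq.const_mul _).mono'
        (hG.aestronglyMeasurable.mul
          (contDiff_iteratedDeriv μ.2.1 (k + n)).continuous.aestronglyMeasurable)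
        (ae_of_all _ (hbound μ A hA))
    refine ⟨{ toFun := fun μ ↦ ∫ x, G x * iteratedDeriv (k + n) μ.1.1 x
              map_add' := fun μ ν ↦ ?_
              map_smul' := fun c μ ↦ ?_ }, fun _ ↦ rfl, C * B * Real.pi, k + n, fun μ A hA ↦ ?_⟩
    · rw [← integral_add (hInt μ) (hInt ν)]
      congr 1
      ext x
      rw [← mul_add, Submodule.coe_add, Prod.fst_add, iteratedDeriv_add
        (μ.2.1.contDiffAt.of_le (mod_cast le_top)) (ν.2.1.contDiffAt.of_le (mod_cast le_top))]
    · rw [RingHom.id_apply, smul_eq_mul, ← integral_const_mul]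
      congr 1
      ext x
      rw [Submodule.coe_smul, Prod.smul_fst, iteratedDeriv_const_smul_field, smul_eq_mul]
      ring
    · refine (norm_integral_le_of_norm_le (integrable_inv_one_add_sq.const_mul _)
        (ae_of_all _ (hbound μ A hA))).trans_eq ?_
      rw [integral_const_mul, integral_univ_inv_one_add_sq]
      ring

theorem integral_eq_integral_comp_inv (F : ℝ → ℂ) :
    ∫ x, F x = ∫ y : ℝ, ((y : ℂ) ^ 2)⁻¹ * F y⁻¹ := by
  have himg : (fun y : ℝ ↦ y⁻¹) '' {0}ᶜ = {0}ᶜ := by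
    ext x
    simp only [Set.mem_image, Set.mem_compl_iff, Set.mem_singleton_iff]
    exact ⟨fun ⟨y, hy, e⟩ ↦ e ▸ inv_ne_zero hy, fun hx ↦ ⟨x⁻¹, inv_ne_zero hx, inv_inv x⟩⟩
  have h := integral_image_eq_integral_abs_deriv_smul (s := {0}ᶜ) (f := fun y : ℝ ↦ y⁻¹)
    (f' := fun y ↦ -(y ^ 2)⁻¹) (measurableSet_singleton 0).compl
    (fun x hx ↦ (hasDerivAt_inv hx).hasDerivWithinAt) inv_injective.injOn F
  have hae : ({0}ᶜ : Set ℝ) =ᵐ[volume] Set.univ := by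
    rw [← ae_eq_set_compl_compl]; simp
  rw [himg, setIntegral_congr_set hae, setIntegral_univ, setIntegral_congr_set hae,
    setIntegral_univ] at h
  rw [h]
  congr 1
  ext y
  rw [abs_neg, abs_of_nonneg (by positivity), Complex.real_smul]
  push_cast
  rfl

/-- After `x = 1 / y`, the Jacobian `y ^ (-2)` cancels two of the `2 + k + n + l` powers of `y`. Of
the others, `y ^ n` makes `G (1 / y)` locally bounded and `y ^ (k + l)` is what order `k` requires
beside `l` derivatives. -/
theorem infinityForms_comp_invDensity_mem_vanishingForms {k : ℕ} {Φ : (ℝ → ℂ) → ℂ}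
    (hΦ : Φ ∈ infinityForms k) : (fun ψ : Test ↦ Φ (invDensity ψ)) ∈ vanishingForms k := by
  induction hΦ using Submodule.span_induction with
  | zero => exact Submodule.zero_mem _
  | add Φ₁ Φ₂ _ _ h₁ h₂ => exact Submodule.add_mem _ h₁ h₂
  | smul c Φ _ h => exact Submodule.smul_mem _ c h
  | mem Φ hΦ =>
    obtain ⟨n, G, C, hG, hGC, rfl⟩ := hΦ
    obtain ⟨c, hc⟩ := exists_iteratedDeriv_invDensity_eq (k + n)
    have hC0 : 0 ≤ C := by simpa using (norm_nonneg _).trans (hGC 0)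
    let h (y : ℝ) : ℂ := G y⁻¹ * (y : ℂ) ^ n
    have hhm : Measurable h :=
      (hG.comp measurable_inv).mul (contDiff_ofReal_pow n).continuous.measurable
    have hhC (y : ℝ) : ‖h y‖ ≤ C * (1 + |y|) ^ n := by
      have h1 : (1 + |y⁻¹|) * |y| ≤ 1 + |y| := by
        by_cases hy : y = 0
        · simp [hy]
        · rw [add_mul, ← abs_mul, inv_mul_cancel₀ hy]
          simp [add_comm]
      calc ‖h y‖ = ‖G y⁻¹‖ * |y| ^ n := by simp [h]
        _ ≤ C * (1 + |y⁻¹|) ^ n * |y| ^ n := by gcongr; exact hGC _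
        _ = C * ((1 + |y⁻¹|) * |y|) ^ n := by rw [mul_pow, mul_assoc]
        _ ≤ _ := by gcongr
    have hh : LocBounded Set.univ h := by
      intro K _ hK
      obtain ⟨R, hR⟩ := hK.isBounded.subset_closedBall 0
      refine memLp_top_of_bound hhm.aestronglyMeasurable (C * (1 + R) ^ n) ?_
      filter_upwards [ae_restrict_mem hK.measurableSet] with y hy
      have : |y| ≤ R := by simpa using hR hy
      exact (hhC y).trans (by gcongr)
    have hmem : ∀ l ∈ Finset.range (k + n + 1), _ := fun l _ ↦ Submodule.smul_mem _ (c l)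
      (integral_mul_pow_mul_iteratedDeriv_mem_vanishingForms k l hh)
    convert Submodule.sum_mem _ hmem using 1
    ext ψ
    simp only [Finset.sum_apply, Pi.smul_apply, smul_eq_mul]
    simp_rw [← integral_const_mul]
    rw [← integral_finsetSum, integral_eq_integral_comp_inv]
    · refine integral_congr_ae ?_
      have h0 : ∀ᵐ x : ℝ, x ≠ 0 := by simp [ae_iff, measure_singleton]
      filter_upwards [h0] with y hy
      have hy' : (y : ℂ) ≠ 0 := by simpa using hy
      rw [hc ψ ψ.contDiff _ (inv_ne_zero hy), inv_inv, Finset.mul_sum, Finset.mul_sum]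
      refine Finset.sum_congr rfl fun l _ ↦ ?_
      rw [show 2 + (k + n) + l = 2 + (n + (k + l)) by omega, pow_add, pow_add (y : ℂ) n]
      simp only [h]
      field_simp
    · intro l _
      exact (hh.integrable_mul ((contDiff_ofReal_pow _).continuous.mul
        (contDiff_iteratedDeriv ψ.contDiff l).continuous)
        (hasCompactSupport_iteratedDeriv ψ.hasCompactSupport l).mul_left).const_mul _

theorem exists_projDist_of_mem_infinityForms {k : ℕ} {Φ : (ℝ → ℂ) → ℂ}
    (hΦ : Φ ∈ infinityForms k) {τ : Test →ₗ[ℂ] ℂ} (hτ : ∀ φ : Test, τ φ = Φ φ) :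
    ∃ T : ProjDist, T.Extends τ ∧ T.VanishesAtInfinity k := by
  obtain ⟨T, hT, C, N, hb⟩ := infinityForms_extends hΦ
  refine ⟨⟨T, 1, C, N, hb⟩, LinearMap.ext fun φ ↦ ?_, vanishesAtZero_of_mem_vanishingForms ?_⟩
  · rw [hτ]
    exact hT _
  · convert infinityForms_comp_invDensity_mem_vanishingForms hΦ using 1
    ext ψ
    exact hT _

/-! ### Fourier transforms of normal forms -/

theorem exists_schwartz_iteratedDeriv (f : 𝓢(ℝ, ℂ)) (n : ℕ) :
    ∃ g : 𝓢(ℝ, ℂ), ⇑g = iteratedDeriv n f := by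
  induction n with
  | zero => exact ⟨f, by simp⟩
  | succ n ih =>
    obtain ⟨g, hg⟩ := ih
    refine ⟨SchwartzMap.derivCLM ℂ ℂ g, ?_⟩
    ext x
    rw [SchwartzMap.derivCLM_apply, iteratedDeriv_succ, hg]

theorem hasTemperateGrowth_ofReal_pow (n : ℕ) :
    (fun x : ℝ ↦ (x : ℂ) ^ n).HasTemperateGrowth :=
  Function.HasTemperateGrowth.pow Complex.ofRealCLM.hasTemperateGrowth n

theorem exists_schwartz_pow_mul (f : 𝓢(ℝ, ℂ)) (n : ℕ) :
    ∃ g : 𝓢(ℝ, ℂ), ⇑g = fun x : ℝ ↦ (x : ℂ) ^ n * f x :=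
  ⟨SchwartzMap.smulLeftCLM ℂ (fun x : ℝ ↦ (x : ℂ) ^ n) f, by
    ext x
    rw [SchwartzMap.smulLeftCLM_apply_apply (hasTemperateGrowth_ofReal_pow n), smul_eq_mul]⟩

theorem integrable_pow_mul_iteratedDeriv (f : 𝓢(ℝ, ℂ)) (n i : ℕ) :
    Integrable fun x : ℝ ↦ (x : ℂ) ^ n * iteratedDeriv i f x := by
  obtain ⟨g, hg⟩ := exists_schwartz_iteratedDeriv f i
  obtain ⟨u, hu⟩ := exists_schwartz_pow_mul g n
  rw [← hg, ← hu]
  exact u.integrable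

theorem integrable_iteratedDeriv_schwartz (f : 𝓢(ℝ, ℂ)) (i : ℕ) :
    Integrable (iteratedDeriv i f) := by
  simpa using integrable_pow_mul_iteratedDeriv f 0 i

theorem fourier_iteratedDeriv_apply (f : 𝓢(ℝ, ℂ)) (n : ℕ) (x : ℝ) :
    𝓕 (iteratedDeriv n f) x = (2 * Real.pi * Complex.I) ^ n * ((x : ℂ) ^ n * 𝓕 (f : ℝ → ℂ) x) := by
  rw [Real.fourier_iteratedDeriv (N := ⊤) (f.smooth ⊤)
    (fun m _ ↦ integrable_iteratedDeriv_schwartz f m) le_top]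
  simp only [smul_eq_mul]
  ring

theorem iteratedDeriv_fourier_apply (f : 𝓢(ℝ, ℂ)) (n : ℕ) (x : ℝ) :
    iteratedDeriv n (𝓕 (f : ℝ → ℂ)) x =
      (-2 * Real.pi * Complex.I) ^ n * 𝓕 (fun y : ℝ ↦ (y : ℂ) ^ n * f y) x := by
  rw [Real.iteratedDeriv_fourier (N := ⊤) (fun m _ ↦ ?_) le_top]
  · rw [Real.fourier_eq, Real.fourier_eq, ← integral_const_mul]
    congr 1
    ext y
    simp only [Circle.smul_def, smul_eq_mul]
    ring
  · simpa using integrable_pow_mul_iteratedDeriv f m 0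

theorem integral_mul_fourier_eq {h g : ℝ → ℂ} (hh : Integrable h) (hg : Integrable g) :
    ∫ x, h x * 𝓕 g x = ∫ x, 𝓕 h x * g x := by
  have := VectorFourier.integral_fourierIntegral_smul_eq_flip (L := innerₗ ℝ)
    Real.continuous_fourierChar continuous_inner hh hg
  rw [flip_innerₗ] at this
  exact this.symm

theorem continuous_fourier {h : ℝ → ℂ} (hh : Integrable h) : Continuous (𝓕 h) :=
  VectorFourier.fourierIntegral_continuous Real.continuous_fourierChar continuous_inner hh

theorem norm_fourier_le (h : ℝ → ℂ) (x : ℝ) : ‖𝓕 h x‖ ≤ ∫ y, ‖h y‖ :=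
  VectorFourier.norm_fourierIntegral_le_integral_norm _ _ _ _ _

/-- Up to a constant, `x ^ (k + l) * (𝓕 φ)⁽ˡ⁾` is the Fourier transform of the `(k + l)`-th
derivative of `x ^ l * φ`. Moving `𝓕` onto `h` and expanding pairs `φ⁽ᵏ⁺ˡ⁻ʳ⁾` with `𝓕 h * x ^ (l -
r)`, so growth and differentiation order match with `n = l - r`. -/
theorem exists_infinityForm_of_originForm_fourier (k l : ℕ) {h : ℝ → ℂ} (hh : Integrable h) :
    ∃ Ψ ∈ infinityForms k, ∀ φ : 𝓢(ℝ, ℂ), originForm k l h (𝓕 (φ : ℝ → ℂ)) = Ψ φ := by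
  have hpi : (2 * Real.pi * Complex.I : ℂ) ≠ 0 := Complex.two_pi_I_ne_zero
  let a : ℂ := (-2 * Real.pi * Complex.I) ^ l * ((2 * Real.pi * Complex.I) ^ (k + l))⁻¹
  refine ⟨∑ r ∈ Finset.range (l + 1), (a * ((k + l).choose r * l.descFactorial r)) •
    fun u : ℝ → ℂ ↦ ∫ x : ℝ, (𝓕 h x * (x : ℂ) ^ (l - r)) * iteratedDeriv (k + (l - r)) u x,
    Submodule.sum_mem _ fun r _ ↦ Submodule.smul_mem _ _ (Submodule.subset_span
      ⟨l - r, _, ∫ y, ‖h y‖, ?_, fun x ↦ ?_, rfl⟩), fun φ ↦ ?_⟩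
  · exact ((continuous_fourier hh).mul (contDiff_ofReal_pow _).continuous).measurable
  · rw [norm_mul, norm_pow, Complex.norm_real, Real.norm_eq_abs]
    gcongr
    · exact norm_fourier_le h x
    · linarith
  · obtain ⟨w, hw⟩ := exists_schwartz_pow_mul φ l
    have e1 (x : ℝ) : (x : ℂ) ^ (k + l) * iteratedDeriv l (𝓕 (φ : ℝ → ℂ)) x =
        a * 𝓕 (iteratedDeriv (k + l) w) x := by
      rw [iteratedDeriv_fourier_apply, fourier_iteratedDeriv_apply, hw]
      simp only [a]
      field_simp
    have e2 (x : ℝ) : iteratedDeriv (k + l) w x = ∑ r ∈ Finset.range (l + 1),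
        ((k + l).choose r * l.descFactorial r : ℂ) *
          ((x : ℂ) ^ (l - r) * iteratedDeriv (k + (l - r)) φ x) := by
      rw [hw, iteratedDeriv_mul_apply _ (contDiff_ofReal_pow l).contDiffAt (φ.smooth ⊤).contDiffAt]
      symm
      -- More than `l` derivatives annihilate `x ^ l`, so the Leibniz sum stops at `r = l`.
      refine Finset.sum_subset_zero_on_sdiff (Finset.range_mono (by omega)) (fun r hr ↦ ?_)
        fun r hr ↦ ?_
      · have : l < r := by
          simp only [Finset.mem_sdiff, Finset.mem_range, not_lt] at hr
          omega
        rw [iteratedDeriv_ofReal_pow, Nat.descFactorial_of_lt this]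
        simp
      · rw [iteratedDeriv_ofReal_pow,
          show k + l - r = k + (l - r) by have := Finset.mem_range.mp hr; omega]
        ring
    have hInt (r : ℕ) : Integrable fun x : ℝ ↦ a * ((k + l).choose r * l.descFactorial r : ℂ) *
        (𝓕 h x * (x : ℂ) ^ (l - r) * iteratedDeriv (k + (l - r)) φ x) := by
      simp_rw [mul_assoc (𝓕 h _)]
      exact ((integrable_pow_mul_iteratedDeriv φ _ _).bdd_mul
        (continuous_fourier hh).aestronglyMeasurable
        (ae_of_all _ (norm_fourier_le h))).const_mul _
    calc originForm k l h (𝓕 (φ : ℝ → ℂ))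
        = ∫ x, a * (h x * 𝓕 (iteratedDeriv (k + l) w) x) := by
          simp_rw [originForm, e1, mul_left_comm]
      _ = a * ∫ x, 𝓕 h x * iteratedDeriv (k + l) w x := by
          rw [integral_const_mul,
            integral_mul_fourier_eq hh (integrable_iteratedDeriv_schwartz w (k + l))]
      _ = _ := by
          simp only [Finset.sum_apply, Pi.smul_apply, smul_eq_mul]
          simp_rw [← integral_const_mul]
          rw [← integral_finsetSum _ fun r _ ↦ hInt r]
          congr 1
          ext x
          rw [e2, Finset.mul_sum, Finset.mul_sum]
          refine Finset.sum_congr rfl fun r _ ↦ ?_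
          ring

/-- The Leibniz rule moves the cutoff into the integrable factor: `x ^ r` and the `r`-th derivative
of the cutoff go with `h`, leaving a form of the same order evaluated on `𝓕 φ`. -/
theorem exists_infinityForm_of_originForms_cutoff {k : ℕ} {Φ : (ℝ → ℂ) → ℂ}
    (hΦ : Φ ∈ originForms k) {c : ℝ} (hc : 0 < c) :
    ∃ Ψ ∈ infinityForms k, ∀ φ : 𝓢(ℝ, ℂ),
      Φ (fun x ↦ cutoff (c * x) * 𝓕 (φ : ℝ → ℂ) x) = Ψ φ := by
  induction hΦ using Submodule.span_induction with
  | zero => exact ⟨0, Submodule.zero_mem _, fun _ ↦ rfl⟩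
  | add Φ₁ Φ₂ _ _ h₁ h₂ =>
    obtain ⟨Ψ₁, m₁, e₁⟩ := h₁
    obtain ⟨Ψ₂, m₂, e₂⟩ := h₂
    exact ⟨Ψ₁ + Ψ₂, Submodule.add_mem _ m₁ m₂, fun φ ↦ by simp [e₁, e₂]⟩
  | smul a Φ _ h =>
    obtain ⟨Ψ, m, e⟩ := h
    exact ⟨a • Ψ, Submodule.smul_mem _ a m, fun φ ↦ by simp [e]⟩
  | mem Φ hΦ =>
    obtain ⟨i, h, hh, rfl⟩ := hΦ
    let χ (x : ℝ) : ℂ := cutoff (c * x)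
    have hχ : ContDiff ℝ ∞ χ := contDiff_cutoff_mul c
    have hχc : HasCompactSupport χ := by
      simpa using hasCompactSupport_cutoff_mul hc fun _ ↦ 1
    let h' (r : ℕ) (x : ℝ) : ℂ := h x * ((x : ℂ) ^ r * iteratedDeriv r χ x)
    have hh' (r : ℕ) : Integrable (h' r) := integrable_originForm hh hχ hχc r r
    choose Ψ hΨ e using fun r ↦
      exists_infinityForm_of_originForm_fourier k (i - r) (hh' r)
    refine ⟨∑ r ∈ Finset.range (i + 1), (i.choose r : ℂ) • Ψ r,
      Submodule.sum_mem _ fun r _ ↦ Submodule.smul_mem _ _ (hΨ r), fun φ ↦ ?_⟩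
    have hF : ContDiff ℝ ∞ (𝓕 (φ : ℝ → ℂ)) := (𝓕 φ).smooth ⊤
    have hInt (r : ℕ) : Integrable fun x : ℝ ↦ (i.choose r : ℂ) * (h' r x *
        ((x : ℂ) ^ (k + (i - r)) * iteratedDeriv (i - r) (𝓕 (φ : ℝ → ℂ)) x)) := by
      refine ((integrable_mul_of_hasCompactSupport hh (u := fun x : ℝ ↦
        ((x : ℂ) ^ r * iteratedDeriv r χ x) *
          ((x : ℂ) ^ (k + (i - r)) * iteratedDeriv (i - r) (𝓕 (φ : ℝ → ℂ)) x)) ?_ ?_).const_mul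
        (i.choose r : ℂ)).congr (ae_of_all _ fun x ↦ ?_)
      · exact ((contDiff_ofReal_pow r).continuous.mul
          (contDiff_iteratedDeriv hχ r).continuous).mul
          ((contDiff_ofReal_pow _).continuous.mul (contDiff_iteratedDeriv hF _).continuous)
      · exact (hasCompactSupport_iteratedDeriv hχc r).mul_left.mul_right
      · simp only [h']
        ring
    simp only [Finset.sum_apply, Pi.smul_apply, smul_eq_mul, ← e, originForm]
    simp_rw [← integral_const_mul]
    rw [← integral_finsetSum _ fun r _ ↦ hInt r]
    congr 1
    ext x
    rw [iteratedDeriv_mul_apply (f := χ) i hχ.contDiffAt hF.contDiffAt, Finset.mul_sum,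
      Finset.mul_sum]
    refine Finset.sum_congr rfl fun r hr ↦ ?_
    rw [show k + i = r + (k + (i - r)) by have := Finset.mem_range.mp hr; omega, pow_add]
    simp only [h']
    ring

/-! ### The contribution away from the origin -/

theorem exists_seminorm_bound (σ : 𝓢'(ℝ, ℂ)) : ∃ (M : ℕ) (C : ℝ), 0 ≤ C ∧
    ∀ (g : 𝓢(ℝ, ℂ)) (B : ℝ), 0 ≤ B → (∀ p ≤ M, ∀ q ≤ M, ∀ x : ℝ,
      |x| ^ p * ‖iteratedDeriv q g x‖ ≤ B) → ‖σ g‖ ≤ C * B := by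
  let q : Seminorm ℂ 𝓢(ℝ, ℂ) := (normSeminorm ℂ ℂ).comp σ.toLinearMap
  have hq : Continuous q := continuous_norm.comp σ.continuous
  obtain ⟨s, C, -, hC⟩ := Seminorm.bound_of_continuous (schwartz_withSeminorms ℂ ℝ ℂ) q hq
  refine ⟨s.sup fun i ↦ max i.1 i.2, C, C.coe_nonneg, fun g B hB h ↦ ?_⟩
  refine (hC g).trans ?_
  rw [_root_.smul_apply, NNReal.smul_def, smul_eq_mul]
  gcongr
  refine Seminorm.finset_sup_apply_le hB fun i hi ↦ ?_
  have hle : max i.1 i.2 ≤ s.sup fun i ↦ max i.1 i.2 :=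
    Finset.le_sup (f := fun i : ℕ × ℕ ↦ max i.1 i.2) hi
  exact SchwartzMap.seminorm_le_bound' ℂ _ _ _ hB
    (h _ ((le_max_left _ _).trans hle) _ ((le_max_right _ _).trans hle))

/-- `x ^ (-i)`, smoothly cut off near the origin. -/
def cutoffInv (c : ℝ) (i : ℕ) (x : ℝ) : ℂ := (1 - cutoff (c * x)) * ((x : ℂ) ^ i)⁻¹

theorem contDiff_cutoffInv {c : ℝ} (hc : 0 < c) (i : ℕ) : ContDiff ℝ ∞ (cutoffInv c i) := by
  rw [contDiff_iff_contDiffAt]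
  intro x
  by_cases hx : x = 0
  · subst hx
    refine (contDiffAt_const (c := (0 : ℂ))).congr_of_eventuallyEq ?_
    filter_upwards [Metric.ball_mem_nhds (0 : ℝ) (inv_pos.mpr hc)] with y hy
    have hy' : |y| < c⁻¹ := by simpa using hy
    have : cutoff (c * y) = 1 := cutoff_eq_one (by
      rw [abs_mul, abs_of_pos hc]
      calc c * |y| ≤ c * c⁻¹ := by gcongr
        _ = 1 := mul_inv_cancel₀ hc.ne')
    simp [cutoffInv, this]
  · exact (contDiffAt_const.sub (contDiff_cutoff_mul c).contDiffAt).mul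
      ((contDiff_ofReal_pow i).contDiffAt.inv (pow_ne_zero _ (by simpa using hx)))

theorem exists_iteratedDeriv_cutoffInv_eq {c : ℝ} (hc : 0 < c) (i s : ℕ) :
    ∃ a : ℂ, ∀ x : ℝ, 2 / c < |x| →
      iteratedDeriv s (cutoffInv c i) x = a * ((x : ℂ) ^ (i + s))⁻¹ := by
  induction s with
  | zero =>
    refine ⟨1, fun x hx ↦ ?_⟩
    rw [div_lt_iff₀ hc] at hx
    have : cutoff (c * x) = 0 := cutoff_eq_zero (by rw [abs_mul, abs_of_pos hc]; linarith)
    simp [cutoffInv, this]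
  | succ s ih =>
    obtain ⟨a, ha⟩ := ih
    refine ⟨-(a * (i + s : ℕ)), fun x hx ↦ ?_⟩
    have hx0 : x ≠ 0 := by
      rintro rfl
      rw [abs_zero] at hx
      exact absurd hx (by have := div_pos two_pos hc; linarith)
    have hx0' : (x : ℂ) ≠ 0 := by simpa using hx0
    have hev : iteratedDeriv s (cutoffInv c i) =ᶠ[nhds x]
        fun y : ℝ ↦ a * ((y : ℂ) ^ (i + s))⁻¹ := by
      filter_upwards [(isOpen_lt continuous_const continuous_abs).mem_nhds hx] with y hy
        using ha y hy
    have hd := ((((hasDerivAt_id x).ofReal_comp.pow (i + s)).inv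
      (pow_ne_zero _ hx0')).const_mul a).deriv
    rw [iteratedDeriv_succ, hev.deriv_eq]
    refine hd.trans ?_
    rcases Nat.eq_zero_or_pos (i + s) with h | h
    · simp [h]
    · simp only [Pi.pow_apply, id]
      rw [show i + (s + 1) = i + s + 1 by omega]
      obtain ⟨m, hm⟩ := Nat.exists_eq_add_of_lt h
      rw [show i + s = m + 1 by omega, Nat.add_sub_cancel]
      push_cast
      field_simp
      ring

/-- Continuity handles a compact ball; outside it the function is exactly `x ^ (-i)`, and
differentiating only improves the decay. -/
theorem exists_bound_iteratedDeriv_cutoffInv {c : ℝ} (hc : 0 < c) (i s : ℕ) :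
    ∃ C, 0 ≤ C ∧ ∀ x, (1 + |x|) ^ i * ‖iteratedDeriv s (cutoffInv c i) x‖ ≤ C := by
  obtain ⟨a, ha⟩ := exists_iteratedDeriv_cutoffInv_eq hc i s
  obtain ⟨C, hC⟩ := (isCompact_closedBall (0 : ℝ) (max 1 (2 / c))).exists_bound_of_continuousOn
    (f := fun x ↦ ((1 + |x|) ^ i : ℝ) * ‖iteratedDeriv s (cutoffInv c i) x‖)
    (by have := (contDiff_iteratedDeriv (contDiff_cutoffInv hc i) s).continuous; fun_prop)
  refine ⟨max C (2 ^ i * ‖a‖), le_max_of_le_right (by positivity), fun x ↦ ?_⟩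
  rcases le_or_gt |x| (max 1 (2 / c)) with hx | hx
  · exact le_max_of_le_left ((le_abs_self _).trans (hC x (by simpa using hx)))
  · refine le_max_of_le_right ?_
    have hx1 : 1 < |x| := (le_max_left _ _).trans_lt hx
    rw [ha x ((le_max_right _ _).trans_lt hx), norm_mul, norm_inv, norm_pow, Complex.norm_real,
      Real.norm_eq_abs]
    have h1 : (1 + |x|) ^ i ≤ (2 * |x|) ^ i := by gcongr; linarith
    have h2 : (|x| ^ (i + s))⁻¹ ≤ (|x| ^ i)⁻¹ := by
      gcongr
      · exact hx1.le
      · omega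
    calc (1 + |x|) ^ i * (‖a‖ * (|x| ^ (i + s))⁻¹)
        ≤ (2 * |x|) ^ i * (‖a‖ * (|x| ^ i)⁻¹) := by gcongr
      _ = 2 ^ i * ‖a‖ := by
        rw [mul_pow]
        field_simp

theorem hasTemperateGrowth_cutoffInv {c : ℝ} (hc : 0 < c) (i : ℕ) :
    (cutoffInv c i).HasTemperateGrowth := by
  refine ⟨contDiff_cutoffInv hc i, fun s ↦ ?_⟩
  obtain ⟨C, hC0, hC⟩ := exists_bound_iteratedDeriv_cutoffInv hc i s
  refine ⟨0, C, fun x ↦ ?_⟩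
  rw [norm_iteratedFDeriv_eq_norm_iteratedDeriv, pow_zero, mul_one]
  refine le_trans ?_ (hC x)
  exact le_mul_of_one_le_left (norm_nonneg _) (one_le_pow₀ (by linarith [abs_nonneg x]))

/-- Multiplication by `(1 + x ^ 2) ^ n`, as a map from Schwartz functions to `L²`. -/
def weightedToL2 (n : ℕ) : 𝓢(ℝ, ℂ) →L[ℂ] Lp ℂ 2 (volume : Measure ℝ) :=
  (SchwartzMap.toLpCLM ℂ ℂ 2 volume).comp
    (SchwartzMap.smulLeftCLM ℂ fun x : ℝ ↦ (1 + (x : ℂ) ^ 2) ^ n)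

theorem hasTemperateGrowth_weight (n : ℕ) :
    (fun x : ℝ ↦ (1 + (x : ℂ) ^ 2) ^ n).HasTemperateGrowth :=
  ((Function.HasTemperateGrowth.const 1).add (hasTemperateGrowth_ofReal_pow 2)).pow n

theorem norm_weight (n : ℕ) (x : ℝ) : ‖(1 + (x : ℂ) ^ 2) ^ n‖ = (1 + x ^ 2) ^ n := by
  rw [norm_pow, show (1 + (x : ℂ) ^ 2) = ((1 + x ^ 2 : ℝ) : ℂ) by push_cast; rfl,
    Complex.norm_real, Real.norm_of_nonneg (by positivity)]

/-- Cauchy–Schwarz against the square integrable function `(1 + x ^ 2)⁻¹`, at the cost of one extra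
power of the weight. -/
theorem exists_integral_weight_mul_norm_le (M : ℕ) : ∃ K, 0 ≤ K ∧ ∀ f : 𝓢(ℝ, ℂ),
    Integrable (fun x ↦ (1 + x ^ 2) ^ M * ‖f x‖) ∧
    ∫ x, (1 + x ^ 2) ^ M * ‖f x‖ ≤ K * ‖weightedToL2 (M + 1) f‖ := by
  have hpos (x : ℝ) : (0 : ℝ) < 1 + x ^ 2 := by positivity
  have hmem : MemLp (fun x : ℝ ↦ (1 + x ^ 2)⁻¹) 2 := by
    refine (memLp_two_iff_integrable_sq
      integrable_inv_one_add_sq.aestronglyMeasurable).mpr ?_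
    refine integrable_inv_one_add_sq.mono'
      (integrable_inv_one_add_sq.aestronglyMeasurable.pow 2) (ae_of_all _ fun x ↦ ?_)
    rw [Real.norm_of_nonneg (by positivity)]
    exact pow_le_of_le_one (by positivity) (inv_le_one_of_one_le₀ (by nlinarith)) two_ne_zero
  refine ⟨(∫ x : ℝ, ((1 + x ^ 2)⁻¹) ^ (2 : ℝ)) ^ (1 / (2 : ℝ)),
    Real.rpow_nonneg (integral_nonneg fun x ↦ Real.rpow_nonneg (by positivity) _) _,
    fun f ↦ ⟨?_, ?_⟩⟩
  · refine (SchwartzMap.smulLeftCLM ℂ (fun x : ℝ ↦ (1 + (x : ℂ) ^ 2) ^ M)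
      f).integrable.norm.congr (ae_of_all _ fun x ↦ ?_)
    simp only [SchwartzMap.smulLeftCLM_apply_apply (hasTemperateGrowth_weight M), norm_smul,
      norm_weight]
  · let g : 𝓢(ℝ, ℂ) := SchwartzMap.smulLeftCLM ℂ (fun x : ℝ ↦ (1 + (x : ℂ) ^ 2) ^ (M + 1)) f
    have hg (x : ℝ) : ‖g x‖ = (1 + x ^ 2) ^ (M + 1) * ‖f x‖ := by
      simp only [g, SchwartzMap.smulLeftCLM_apply_apply (hasTemperateGrowth_weight (M + 1)),
        norm_smul, norm_weight]
    have hnorm : ‖weightedToL2 (M + 1) f‖ = (∫ x, ‖g x‖ ^ (2 : ℝ)) ^ (1 / (2 : ℝ)) := by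
      have := SchwartzMap.norm_toLp' (f := g) (p := 2) (μ := volume) two_ne_zero (by simp)
      change ‖g.toLp 2 volume‖ = _
      simpa using this
    have hcs := integral_mul_le_Lp_mul_Lq_of_nonneg (μ := volume) Real.HolderConjugate.two_two
      (f := fun x : ℝ ↦ (1 + x ^ 2)⁻¹) (g := fun x ↦ ‖g x‖)
      (ae_of_all _ fun x ↦ by positivity) (ae_of_all _ fun x ↦ norm_nonneg _)
      (by simpa using hmem) (by simpa using (g.memLp 2 volume).norm)
    rw [hnorm]
    refine le_trans (le_of_eq ?_) hcs
    congr 1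
    ext x
    have := (hpos x).ne'
    rw [hg, pow_succ]
    field_simp
    ring

theorem exists_fourier_bound (M : ℕ) : ∃ K, 0 ≤ K ∧ ∀ (f : 𝓢(ℝ, ℂ)), ∀ r ≤ M, ∀ x,
    ‖iteratedDeriv r (𝓕 (f : ℝ → ℂ)) x‖ ≤ K * ‖weightedToL2 (M + 1) f‖ := by
  obtain ⟨K, hK0, hK⟩ := exists_integral_weight_mul_norm_le M
  refine ⟨(1 + 2 * Real.pi) ^ M * K, by positivity, fun f r hr x ↦ ?_⟩
  rw [iteratedDeriv_fourier_apply, norm_mul, norm_pow]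
  have h1 : ‖(-2 * Real.pi * Complex.I : ℂ)‖ = 2 * Real.pi := by
    simp [abs_of_pos Real.pi_pos]
  rw [h1, mul_assoc]
  have h2 : (2 * Real.pi) ^ r ≤ (1 + 2 * Real.pi) ^ M :=
    (pow_le_pow_left₀ (by positivity) (by linarith) r).trans
      (pow_le_pow_right₀ (by linarith [Real.pi_pos]) hr)
  have h3 : ∀ y : ℝ, ‖(y : ℂ) ^ r * f y‖ ≤ (1 + y ^ 2) ^ M * ‖f y‖ := fun y ↦ by
    rw [norm_mul, norm_pow, Complex.norm_real, Real.norm_eq_abs]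
    gcongr
    calc |y| ^ r ≤ (1 + y ^ 2) ^ r := by
          gcongr
          nlinarith [sq_abs y, sq_nonneg (|y| - 1)]
      _ ≤ (1 + y ^ 2) ^ M := pow_le_pow_right₀ (by nlinarith) hr
  have h4 := (norm_fourier_le (fun y : ℝ ↦ (y : ℂ) ^ r * f y) x).trans
    ((integral_mono_of_nonneg (ae_of_all _ fun _ ↦ norm_nonneg _) (hK f).1
      (ae_of_all _ h3)).trans (hK f).2)
  gcongr

/-- The functional `f ↦ σ (w * 𝓕 f)`. -/
def fourierPairing (σ : 𝓢'(ℝ, ℂ)) (w : ℝ → ℂ) : 𝓢(ℝ, ℂ) →ₗ[ℂ] ℂ where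
  toFun f := σ (SchwartzMap.smulLeftCLM ℂ w (𝓕 f))
  map_add' f g := by rw [FourierTransform.fourier_add, map_add, map_add]
  map_smul' a f := by rw [FourierTransform.fourier_smul, map_smul, map_smul, RingHom.id_apply]

/-- Decay of order `i ≥ M` absorbs the polynomial weights in the seminorms bounding `σ`, and
derivatives of `𝓕 f` are controlled by moments of `f`. The weight exponent `M + 1` is fixed before
`i`, which leaves `i` free to be chosen in terms of it. -/
theorem exists_fourierPairing_bound (σ : 𝓢'(ℝ, ℂ)) : ∃ M : ℕ, ∀ {c : ℝ}, 0 < c → ∀ i ≥ M,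
    ∃ K, ∀ f : 𝓢(ℝ, ℂ),
      ‖fourierPairing σ (cutoffInv c i) f‖ ≤ K * ‖weightedToL2 (M + 1) f‖ := by
  obtain ⟨M, C, hC0, hC⟩ := exists_seminorm_bound σ
  refine ⟨M, fun {c} hc i hi ↦ ?_⟩
  obtain ⟨K, hK0, hK⟩ := exists_fourier_bound M
  choose b hb0 hb using exists_bound_iteratedDeriv_cutoffInv hc i
  set S := ∑ s ∈ Finset.range (M + 1), b s with hS
  have hS0 : 0 ≤ S := Finset.sum_nonneg fun s _ ↦ hb0 s
  refine ⟨C * (2 ^ M * (S * K)), fun f ↦ ?_⟩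
  rw [mul_assoc]
  refine hC _ _ (by positivity) fun p hp q hq x ↦ ?_
  have hcoe : ⇑(SchwartzMap.smulLeftCLM ℂ (cutoffInv c i) (𝓕 f)) =
      fun x ↦ cutoffInv c i x * 𝓕 (f : ℝ → ℂ) x := by
    ext x
    rw [SchwartzMap.smulLeftCLM_apply_apply (hasTemperateGrowth_cutoffInv hc i)]
    rfl
  rw [hcoe, iteratedDeriv_mul_apply q (contDiff_cutoffInv hc i).contDiffAt
    ((𝓕 f).smooth ⊤).contDiffAt]
  have hterm : ∀ r ∈ Finset.range (q + 1), |x| ^ p * ‖(q.choose r : ℂ) *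
      iteratedDeriv r (cutoffInv c i) x * iteratedDeriv (q - r) (𝓕 (f : ℝ → ℂ)) x‖ ≤
      q.choose r * (S * K * ‖weightedToL2 (M + 1) f‖) := fun r hr ↦ by
    have hrM : r ≤ M := by have := Finset.mem_range.mp hr; omega
    have h1 : |x| ^ p ≤ (1 + |x|) ^ i :=
      (pow_le_pow_left₀ (abs_nonneg x) (by linarith) p).trans
        (pow_le_pow_right₀ (by linarith [abs_nonneg x]) (hp.trans hi))
    have h2 : |x| ^ p * ‖iteratedDeriv r (cutoffInv c i) x‖ ≤ S :=
      ((mul_le_mul_of_nonneg_right h1 (norm_nonneg _)).trans (hb r x)).trans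
        (Finset.single_le_sum (f := b) (fun s _ ↦ hb0 s) (Finset.mem_range.mpr (by omega)))
    have h3 := hK f (q - r) (by omega) x
    rw [norm_mul, norm_mul, Complex.norm_natCast]
    calc |x| ^ p * (q.choose r * ‖iteratedDeriv r (cutoffInv c i) x‖ *
          ‖iteratedDeriv (q - r) (𝓕 (f : ℝ → ℂ)) x‖)
        = q.choose r * ((|x| ^ p * ‖iteratedDeriv r (cutoffInv c i) x‖) *
          ‖iteratedDeriv (q - r) (𝓕 (f : ℝ → ℂ)) x‖) := by ring
      _ ≤ q.choose r * (S * (K * ‖weightedToL2 (M + 1) f‖)) := by gcongr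
      _ = _ := by ring
  calc _ ≤ |x| ^ p * ∑ r ∈ Finset.range (q + 1), ‖(q.choose r : ℂ) *
        iteratedDeriv r (cutoffInv c i) x * iteratedDeriv (q - r) (𝓕 (f : ℝ → ℂ)) x‖ := by
        gcongr
        exact norm_sum_le _ _
    _ ≤ ∑ r ∈ Finset.range (q + 1), q.choose r * (S * K * ‖weightedToL2 (M + 1) f‖) := by
        rw [Finset.mul_sum]
        exact Finset.sum_le_sum hterm
    _ = 2 ^ q * (S * K * ‖weightedToL2 (M + 1) f‖) := by
        rw [← Finset.sum_mul]
        congr 1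
        exact_mod_cast Nat.sum_range_choose q
    _ ≤ 2 ^ M * (S * K * ‖weightedToL2 (M + 1) f‖) := by
        gcongr
        norm_num
    _ = _ := by ring

theorem exists_inner_eq_of_norm_le {V E : Type*} [AddCommGroup V] [Module ℂ V]
    [NormedAddCommGroup E] [InnerProductSpace ℂ E] [CompleteSpace E] (Λ : V →ₗ[ℂ] ℂ)
    (A : V →ₗ[ℂ] E) (h : ∃ K, ∀ v, ‖Λ v‖ ≤ K * ‖A v‖) : ∃ e : E, ∀ v, Λ v = inner ℂ e (A v) := by
  -- The bound makes `Λ` factor through the range of `A`; extend by Hahn–Banach and represent by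
  -- Riesz.
  obtain ⟨g, hg, -⟩ := exists_extension_norm_eq (LinearMap.range A) (Λ.compLeftInverse A)
  refine ⟨(InnerProductSpace.toDual ℂ E).symm g, fun v ↦ ?_⟩
  rw [InnerProductSpace.toDual_symm_apply, ← Λ.compLeftInverse_apply_of_bdd A h v _ rfl]
  exact (hg ⟨A v, v, rfl⟩).symm

/-- Integration by parts against the primitive of a locally integrable function. -/
theorem integral_mul_eq_neg_integral_primitive_mul_deriv {G f : ℝ → ℂ} (hG : LocallyIntegrable G)
    (hf : ContDiff ℝ ∞ f) (hc : HasCompactSupport f) :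
    ∫ x, G x * f x = -∫ x, (∫ t in (0 : ℝ)..x, G t) * deriv f x := by
  obtain ⟨R, hR⟩ := hc.isBounded.subset_closedBall 0
  obtain ⟨R, hR0, hfR⟩ : ∃ R, 0 < R ∧ ∀ x, R ≤ |x| → f x = 0 ∧ deriv f x = 0 := by
    refine ⟨|R| + 1, by positivity, fun x hx ↦ ?_⟩
    have hx' : x ∉ tsupport f := fun h ↦ by
      have : |x| ≤ R := by simpa using hR h
      linarith [le_abs_self R]
    exact ⟨image_eq_zero_of_notMem_tsupport hx', by
      simpa using iteratedDeriv_eq_zero_of_notMem_tsupport hx' 1⟩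
  have hGi (a b : ℝ) : IntervalIntegrable G volume a b :=
    (hG.integrableOn_isCompact isCompact_uIcc).intervalIntegrable
  have hf' : Continuous (deriv f) := hf.continuous_deriv (by simp)
  have hder (x : ℝ) : HasDerivAt f (deriv f x) x :=
    (hf.differentiable (by simp)).differentiableAt.hasDerivAt
  let S := Set.Ioc (-R) R
  have hS : MeasurableSet S := measurableSet_Ioc
  have hout : ∀ x ∉ S, f x = 0 ∧ deriv f x = 0 := fun x hx ↦ hfR x (by
    simp only [S, Set.mem_Ioc, not_and_or, not_lt, not_le] at hx
    rcases hx with h | h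
    · exact le_abs.mpr (Or.inr (by linarith))
    · exact le_abs.mpr (Or.inl h.le))
  have hGS : Integrable G (volume.restrict S) := (hGi (-R) R).1
  have hfS : Integrable (deriv f) (volume.restrict S) := (hf'.intervalIntegrable (-R) R).1
  -- Fubini on the triangle `x < t`: integrating over `t` first gives `-(G * f)`, over `x` first
  -- gives the primitive times `deriv f`. No continuity of `G` is needed.
  let K : ℝ × ℝ → ℂ := {p : ℝ × ℝ | p.1 < p.2}.indicator fun p ↦ G p.1 * deriv f p.2
  have hK : Integrable K ((volume.restrict S).prod (volume.restrict S)) :=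
    (hGS.mul_prod hfS).indicator (measurableSet_lt measurable_fst measurable_snd)
  have hswap := integral_integral_swap (f := fun x t ↦ K (x, t)) hK
  have hleft : ∀ x ∈ S, ∫ t in S, K (x, t) = -(G x * f x) := fun x hx ↦ by
    have h1 : (fun t ↦ K (x, t)) = (Set.Ioi x).indicator fun t ↦ G x * deriv f t := by
      ext t
      simp only [K, Set.indicator_apply, Set.mem_ofPred_eq, Set.mem_Ioi]
    have h2 : S ∩ Set.Ioi x = Set.Ioc x R := by
      ext t
      simp only [S, Set.mem_inter_iff, Set.mem_Ioc, Set.mem_Ioi]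
      have := hx.1
      constructor
      · rintro ⟨⟨_, h⟩, h'⟩
        exact ⟨h', h⟩
      · rintro ⟨h, h'⟩
        exact ⟨⟨by linarith, h'⟩, h⟩
    rw [h1, setIntegral_indicator measurableSet_Ioi, h2, integral_const_mul,
      ← intervalIntegral.integral_of_le hx.2,
      intervalIntegral.integral_eq_sub_of_hasDerivAt (fun t _ ↦ hder t)
        (hf'.intervalIntegrable _ _), (hfR R (le_abs_self R)).1]
    ring
  have hright : ∀ t ∈ S, ∫ x in S, K (x, t) = (∫ x in (-R)..t, G x) * deriv f t := fun t ht ↦ by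
    have h1 : (fun x ↦ K (x, t)) = (Set.Iio t).indicator fun x ↦ G x * deriv f t := by
      ext x
      simp only [K, Set.indicator_apply, Set.mem_ofPred_eq, Set.mem_Iio]
    have h2 : S ∩ Set.Iio t = Set.Ioo (-R) t := by
      ext x
      simp only [S, Set.mem_inter_iff, Set.mem_Ioc, Set.mem_Iio, Set.mem_Ioo]
      have := ht.2
      constructor
      · rintro ⟨⟨h, _⟩, h'⟩
        exact ⟨h, h'⟩
      · rintro ⟨h, h'⟩
        exact ⟨⟨h, by linarith⟩, h'⟩
    rw [h1, setIntegral_indicator measurableSet_Iio, h2, integral_mul_const,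
      ← integral_Ioc_eq_integral_Ioo, ← intervalIntegral.integral_of_le ht.1.le]
  rw [setIntegral_congr_fun hS hleft, setIntegral_congr_fun hS hright, integral_neg] at hswap
  -- The base point of the primitive may be moved from `-R` to `0` because `deriv f` has integral
  -- zero.
  have hsplit : ∫ t in S, (∫ x in (-R)..t, G x) * deriv f t =
      ∫ t in S, (∫ x in (0 : ℝ)..t, G x) * deriv f t := by
    have hP : Continuous fun t ↦ ∫ x in (0 : ℝ)..t, G x :=
      intervalIntegral.continuous_primitive (fun a b ↦ hGi a b) 0
    have h0 : ∫ t in S, deriv f t = 0 := by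
      rw [← intervalIntegral.integral_of_le (by linarith),
        intervalIntegral.integral_eq_sub_of_hasDerivAt (fun t _ ↦ hder t)
        (hf'.intervalIntegrable _ _), (hfR R (le_abs_self R)).1,
        (hfR (-R) (by rw [abs_neg]; exact le_abs_self R)).1, sub_zero]
    have h1 (t : ℝ) : (∫ x in (-R)..t, G x) * deriv f t =
        (∫ x in (-R)..0, G x) * deriv f t + (∫ x in (0 : ℝ)..t, G x) * deriv f t := by
      rw [← add_mul, intervalIntegral.integral_add_adjacent_intervals (hGi _ _) (hGi _ _)]
    have hPf : Integrable (fun t ↦ (∫ x in (0 : ℝ)..t, G x) * deriv f t) (volume.restrict S) :=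
      ((hP.mul hf').intervalIntegrable (-R) R).1
    simp_rw [h1]
    rw [integral_add (hfS.const_mul _) hPf,
      integral_const_mul, h0, mul_zero, zero_add]
  rw [hsplit] at hswap
  rw [setIntegral_eq_integral_of_forall_compl_eq_zero fun x hx ↦ by simp [(hout x hx).1],
    setIntegral_eq_integral_of_forall_compl_eq_zero fun x hx ↦ by simp [(hout x hx).2]] at hswap
  rw [← hswap, neg_neg]

theorem locallyIntegrable_mul_of_memLp {H w : ℝ → ℂ} (hH : MemLp H 2) (hw : Continuous w) :
    LocallyIntegrable fun x ↦ H x * w x :=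
  (hH.locallyIntegrable one_le_two).mul_continuous hw

/-- Taking a primitive converts square integrability into a pointwise bound, as infinity forms
require. The inequality `‖H‖ ≤ 1 + ‖H‖ ^ 2` is enough here. -/
theorem norm_primitive_le {H : ℝ → ℂ} (hH : MemLp H 2) (n : ℕ) (x : ℝ) :
    ‖∫ t in (0 : ℝ)..x, H t * (1 + (t : ℂ) ^ 2) ^ n‖ ≤
      (1 + ∫ t, ‖H t‖ ^ 2) * (1 + |x|) ^ (2 * n + 1) := by
  have hsq : Integrable fun t ↦ ‖H t‖ ^ 2 := hH.integrable_norm_pow two_ne_zero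
  have hI0 : 0 ≤ ∫ t, ‖H t‖ ^ 2 := integral_nonneg fun t ↦ by positivity
  have hfin : volume (Set.uIoc 0 x) ≠ ⊤ := by simp [Set.uIoc]
  have hInt : IntegrableOn (fun t ↦ (1 + x ^ 2) ^ n * (1 + ‖H t‖ ^ 2)) (Set.uIoc 0 x) :=
    ((integrableOn_const hfin).add hsq.integrableOn).const_mul _
  have hvol : (volume : Measure ℝ).real (Set.uIoc 0 x) = |x| := by
    simp [Measure.real, Real.volume_uIoc]
  calc ‖∫ t in (0 : ℝ)..x, H t * (1 + (t : ℂ) ^ 2) ^ n‖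
      ≤ ∫ t in Set.uIoc 0 x, ‖H t * (1 + (t : ℂ) ^ 2) ^ n‖ :=
        intervalIntegral.norm_integral_le_integral_norm_uIoc
    _ ≤ ∫ t in Set.uIoc 0 x, (1 + x ^ 2) ^ n * (1 + ‖H t‖ ^ 2) := by
        refine integral_mono_of_nonneg (ae_of_all _ fun _ ↦ norm_nonneg _) hInt ?_
        filter_upwards [ae_restrict_mem measurableSet_uIoc] with t ht
        have ht' : |t| ≤ |x| := by
          have := Set.abs_sub_left_of_mem_uIcc (Set.uIoc_subset_uIcc ht)
          simpa using this
        have h1 : t ^ 2 ≤ x ^ 2 := sq_le_sq.mpr ht'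
        have h2 : ‖H t‖ ≤ 1 + ‖H t‖ ^ 2 := by nlinarith [sq_nonneg (‖H t‖ - 1), norm_nonneg (H t)]
        rw [norm_mul, norm_weight, mul_comm]
        gcongr
    _ = (1 + x ^ 2) ^ n * (|x| + ∫ t in Set.uIoc 0 x, ‖H t‖ ^ 2) := by
        have h1 : Integrable (fun _ ↦ (1 : ℝ)) (volume.restrict (Set.uIoc 0 x)) :=
          integrableOn_const hfin
        rw [integral_const_mul, integral_add h1 hsq.integrableOn]
        simp [hvol]
    _ ≤ (1 + x ^ 2) ^ n * (|x| + ∫ t, ‖H t‖ ^ 2) := by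
        have := setIntegral_le_integral (s := Set.uIoc 0 x) hsq
          (ae_of_all _ fun t ↦ by positivity)
        gcongr
    _ ≤ ((1 + |x|) ^ 2) ^ n * ((1 + ∫ t, ‖H t‖ ^ 2) * (1 + |x|)) := by
        have h0 := abs_nonneg x
        gcongr
        · nlinarith [sq_abs x]
        · nlinarith
    _ = _ := by rw [← pow_mul]; ring

/-- On the support of `1 - cutoff`, `𝓕 φ` is a constant times `x ^ (-i) * 𝓕 (φ⁽ⁱ⁾)`. The resulting
functional of `φ⁽ⁱ⁾` is integration against a square integrable function times `(1 + x ^ 2) ^ n`,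
and one integration by parts makes this a form at infinity. -/
theorem exists_infinityForm_away (σ : 𝓢'(ℝ, ℂ)) (k : ℕ) {c : ℝ} (hc : 0 < c) :
    ∃ Ψ ∈ infinityForms k, ∀ (φ g : 𝓢(ℝ, ℂ)), HasCompactSupport φ →
      (∀ x, g x = (1 - cutoff (c * x)) * 𝓕 (φ : ℝ → ℂ) x) → σ g = Ψ φ := by
  obtain ⟨M, hM⟩ := exists_fourierPairing_bound σ
  set n := M + 1 with hn
  -- The primitive below grows like `|x| ^ (2 * n + 1)` and meets `i + 1` derivatives, so order `k`
  -- needs `i + 1 = k + (2 * n + 1)`.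
  set i := k + 2 * n with hi
  obtain ⟨H, hH⟩ := exists_inner_eq_of_norm_le (fourierPairing σ (cutoffInv c i))
    (weightedToL2 n).toLinearMap (hM hc i (by omega))
  -- The inner product is conjugate linear in its first argument.
  let H' (x : ℝ) : ℂ := star (H x)
  have hH' : MemLp H' 2 := (Lp.memLp H).star
  have hwc : Continuous fun x : ℝ ↦ (1 + (x : ℂ) ^ 2) ^ n :=
    (hasTemperateGrowth_weight n).1.continuous
  let G (x : ℝ) : ℂ := H' x * (1 + (x : ℂ) ^ 2) ^ n
  have hG : LocallyIntegrable G := locallyIntegrable_mul_of_memLp hH' hwc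
  have hrep (f : 𝓢(ℝ, ℂ)) : fourierPairing σ (cutoffInv c i) f = ∫ x, G x * f x := by
    rw [hH, L2.inner_def]
    refine integral_congr_ae ?_
    have := SchwartzMap.coeFn_toLp
      (SchwartzMap.smulLeftCLM ℂ (fun x : ℝ ↦ (1 + (x : ℂ) ^ 2) ^ n) f) 2 volume
    filter_upwards [this] with x hx
    change inner ℂ (H x) ((SchwartzMap.toLp (SchwartzMap.smulLeftCLM ℂ
      (fun x : ℝ ↦ (1 + (x : ℂ) ^ 2) ^ n) f) 2 volume : Lp ℂ 2 volume) x) = _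
    rw [hx, SchwartzMap.smulLeftCLM_apply_apply (hasTemperateGrowth_weight n), RCLike.inner_apply]
    simp only [G, H', smul_eq_mul, RCLike.star_def]
    ring
  have hpi : (2 * Real.pi * Complex.I : ℂ) ≠ 0 := Complex.two_pi_I_ne_zero
  refine ⟨(-((2 * Real.pi * Complex.I) ^ i)⁻¹ : ℂ) • fun u ↦
    ∫ x, (∫ t in (0 : ℝ)..x, G t) * iteratedDeriv (k + (2 * n + 1)) u x,
    Submodule.smul_mem _ _ (Submodule.subset_span ⟨2 * n + 1, _, _,
      (intervalIntegral.continuous_primitive (fun a b ↦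
        (hG.integrableOn_isCompact isCompact_uIcc).intervalIntegrable) 0).measurable,
      norm_primitive_le hH' n, rfl⟩), fun φ g hφ hg ↦ ?_⟩
  obtain ⟨f, hf⟩ := exists_schwartz_iteratedDeriv φ i
  have hgf : g = ((2 * Real.pi * Complex.I : ℂ) ^ i)⁻¹ •
      SchwartzMap.smulLeftCLM ℂ (cutoffInv c i) (𝓕 f) := by
    ext x
    rw [hg, _root_.smul_apply, SchwartzMap.smulLeftCLM_apply_apply
      (hasTemperateGrowth_cutoffInv hc i), SchwartzMap.fourier_coe, hf,
      fourier_iteratedDeriv_apply, cutoffInv]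
    by_cases hx : x = 0
    · simp [hx, cutoff_eq_one]
    · have hx' : (x : ℂ) ≠ 0 := by simpa using hx
      simp only [smul_eq_mul]
      field_simp
  have hcf : HasCompactSupport f := hf ▸ hasCompactSupport_iteratedDeriv hφ i
  rw [hgf, map_smul]
  change _ • fourierPairing σ (cutoffInv c i) f = _
  rw [hrep, integral_mul_eq_neg_integral_primitive_mul_deriv hG (f.smooth ⊤) hcf, hf,
    ← iteratedDeriv_succ, Pi.smul_apply, smul_eq_mul, smul_eq_mul,
    show i + 1 = k + (2 * n + 1) by omega]
  ring

/-! ### Assembling the proof -/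

theorem exists_infinityForm_fourier {σ : 𝓢'(ℝ, ℂ)} {k : ℕ}
    (hσ : VanishesAtZero k (ofTempered σ)) :
    ∃ Ψ ∈ infinityForms k, ∀ φ : Test, ofTempered (𝓕 σ) φ = Ψ φ := by
  obtain ⟨ε, hε, Φ, hΦ, e⟩ := hσ.exists_originForm
  -- With `c = 2 / ε` the cutoff is supported in the ball of radius `2 / c = ε`, where the normal
  -- form is valid.
  have hc : 0 < 2 / ε := by positivity
  obtain ⟨Ψ₁, m₁, e₁⟩ := exists_infinityForm_of_originForms_cutoff hΦ hc
  obtain ⟨Ψ₂, m₂, e₂⟩ := exists_infinityForm_away σ k hc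
  refine ⟨Ψ₁ + Ψ₂, Submodule.add_mem _ m₁ m₂, fun φ ↦ ?_⟩
  let f : 𝓢(ℝ, ℂ) := φ.hasCompactSupport.toSchwartzMap φ.contDiff
  let χf : Test := testOf (fun x ↦ cutoff (2 / ε * x) * 𝓕 (f : ℝ → ℂ) x)
    ((contDiff_cutoff_mul _).mul ((𝓕 f).smooth ⊤)) (hasCompactSupport_cutoff_mul hc _)
  let g : 𝓢(ℝ, ℂ) := χf.hasCompactSupport.toSchwartzMap χf.contDiff
  have h1 : σ g = Ψ₁ f := by
    rw [← e₁]
    refine e χf ((tsupport_cutoff_mul_subset hc _).trans (Metric.closedBall_subset_closedBall ?_))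
    rw [div_div_cancel₀ two_ne_zero]
  have h2 : σ (𝓕 f - g) = Ψ₂ f := e₂ f _ φ.hasCompactSupport fun x ↦ by
    change 𝓕 (f : ℝ → ℂ) x - cutoff (2 / ε * x) * 𝓕 (f : ℝ → ℂ) x = _
    ring
  rw [map_sub, h1, sub_eq_iff_eq_add] at h2
  change σ (𝓕 f) = Ψ₁ f + Ψ₂ f
  rw [h2, add_comm]

end VanishingDist

end

theorem mainTheorem1 (σ : 𝓢'(ℝ, ℂ)) :
    (∀ k : ℕ, VanishingDist.VanishesAtZero k (VanishingDist.ofTempered σ) →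
      ∃ T : VanishingDist.ProjDist,
        T.Extends (VanishingDist.ofTempered (𝓕 σ)) ∧ T.VanishesAtInfinity k) ∧
    ((∀ k : ℕ, VanishingDist.VanishesAtZero k (VanishingDist.ofTempered σ)) →
      VanishingDist.HasCanonicalExtension (VanishingDist.ofTempered (𝓕 σ))) := by
  have ha : ∀ k : ℕ, VanishingDist.VanishesAtZero k (VanishingDist.ofTempered σ) →
      ∃ T : VanishingDist.ProjDist,
        T.Extends (VanishingDist.ofTempered (𝓕 σ)) ∧ T.VanishesAtInfinity k := fun k hk ↦ by
    obtain ⟨Ψ, hΨ, e⟩ := VanishingDist.exists_infinityForm_fourier hk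
    exact VanishingDist.exists_projDist_of_mem_infinityForms hΨ e
  refine ⟨ha, fun h ↦ ?_⟩
  -- Uniqueness holds already among extensions vanishing to order `0`, so this `T` equals the
  -- extension obtained for each `k` and inherits its order of vanishing.
  obtain ⟨T, hT, hT0⟩ := ha 0 (h 0)
  refine ⟨T, ⟨hT, fun k ↦ ?_⟩, fun T' ⟨hT', hv'⟩ ↦
    VanishingDist.ProjDist.eq_of_vanishesAtInfinity hT' hT (hv' 0) hT0⟩
  obtain ⟨S, hS, hSk⟩ := ha k (h k)
  rwa [VanishingDist.ProjDist.eq_of_vanishesAtInfinity hT hS hT0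
    (VanishingDist.VanishesAtZero.mono (Nat.zero_le k) hSk)]
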